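/- **Setting.** Let $G$ be a compact Lie group with Lie algebra $\mathfrak g$, $H\subset G$ a closed subgroup with Lie algebra $\mathfrak h$, $Q$ an $\mathrm{Ad}_G$-invariant inner product on $\mathfrak g$, and $\mathfrak m=\mathfrak h^{\perp_Q}$, identified with the tangent space of $M=G/H$ at the base point. Assume that $\mathfrak m$ is not contained in the center of $\mathfrak g$ (this is the case whenever $G$ is connected and $G/H$ is not covered by a torus). Let $\mathcal T$ be the finite-dimensional vector space of $G$-invariant symmetric $(0,2)$-tensor fields on $M$, i.e. of $\mathrm{Ad}_H$-invariant symmetric bilinear forms on $\mathfrak m$, and let $\mathcal M\subset\mathcal T$ be the open subset of $G$-invariant Riemannian metrics, i.e. of positive-definite elements. For $g\in\mathcal M$ let $\mathrm{Ric}(g)$ be its Ricci tensor, $S(g)=\mathrm{tr}_g\,\mathrm{Ric}(g)$ its scalar curvature, and $\langle A,B\rangle_g=\mathrm{tr}(g^{-1}A\,g^{-1}B)$ the inner product induced by $g$ on $\mathcal T$. For positive-definite $T\in\mathcal T$ let $\mathcal M_T=\{g\in\mathcal M\mid \mathrm{tr}_gT=1\}$. **Proposition.** The Ricci curvature is a smooth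 map $\mathrm{Ric}\colon\mathcal M\to\mathcal T$; denote by $d\mathrm{Ric}_g$ its differential at $g$. Moreover: 1. If $T\in\mathcal T$ is positive definite and $g$ is a critical point of $S_{|\mathcal M_T}$, then $$\mathrm{Hess}(S_{|\mathcal M_T})_g(X,Y)=-\langle d\mathrm{Ric}_g(X),Y\rangle_g\qquad\text{for all }X,Y\in T_g\mathcal M_T .$$ 2. If $T\in\mathcal T$ is positive definite and $\mathrm{Ric}(g)=cT$ for some $g\in\mathcal M_T$ and $c>0$, then $g$ is a non-degenerate critical point of $S_{|\mathcal M_T}$ if and only if $d\mathrm{Ric}_g$ has rank $\dim\mathcal M-1$. 3. For all positive-definite $T$ outside a set of Lebesgue measure zero in $\mathcal T$, the function $S\colon\mathcal M_T\to\mathbb R$ is a Morse function, i.e. it is smooth and all its critical points are non-degenerate. -/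

import Mathlib

open scoped Manifold ContDiff Topology

set_option maxSynthPendingDepth 3

noncomputable section

namespace HomSpace

/-! ### The Lie algebra, the adjoint action, closed subgroups -/

section Group

variable {E : Type*} [NormedAddCommGroup E] [NormedSpace ℝ E]
  {G : Type*} [TopologicalSpace G] [ChartedSpace E G] [Group G]

/-- The adjoint action of `a`: the derivative at `1` of the conjugation `x ↦ a x a⁻¹`. -/
def Ad (E : Type*) [NormedAddCommGroup E] [NormedSpace ℝ E]
    {G : Type*} [TopologicalSpace G] [ChartedSpace E G] [Group G] (a : G) :
    GroupLieAlgebra 𝓘(ℝ, E) G →ₗ[ℝ] GroupLieAlgebra 𝓘(ℝ, E) G :=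
  (mfderiv 𝓘(ℝ, E) 𝓘(ℝ, E) (fun x : G => a * x * a⁻¹) 1 : E →L[ℝ] E).toLinearMap

/-- `X` is the velocity at time `0` of a curve through `1` that stays in the subgroup `H`. -/
def IsVelocity (H : Subgroup G) (X : GroupLieAlgebra 𝓘(ℝ, E) G) : Prop :=
  ∃ γ : ℝ → G, (∀ t, γ t ∈ H) ∧ γ 0 = 1 ∧
    HasMFDerivAt 𝓘(ℝ, ℝ) 𝓘(ℝ, E) γ 0
      (ContinuousLinearMap.toSpanSingleton ℝ (X : E) : ℝ →L[ℝ] E)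

/-- The Lie algebra `𝔥 ⊆ 𝔤` of a (closed) subgroup `H`: the velocities at `1` of curves in `H`. -/
def subgroupLieAlgebra (E : Type*) [NormedAddCommGroup E] [NormedSpace ℝ E]
    {G : Type*} [TopologicalSpace G] [ChartedSpace E G] [Group G] (H : Subgroup G) :
    Submodule ℝ (GroupLieAlgebra 𝓘(ℝ, E) G) :=
  Submodule.span ℝ {X | IsVelocity H X}

/-- A bi-invariant metric on `G`: an `Ad G`-invariant inner product on the Lie algebra. -/
structure BiinvariantMetric (E : Type*) [NormedAddCommGroup E] [NormedSpace ℝ E]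
    (G : Type*) [TopologicalSpace G] [ChartedSpace E G] [Group G] where
  /-- the underlying bilinear form on the Lie algebra -/
  form : LinearMap.BilinForm ℝ (GroupLieAlgebra 𝓘(ℝ, E) G)
  symm : ∀ X Y, form X Y = form Y X
  pos : ∀ X, X ≠ 0 → 0 < form X X
  invariant : ∀ (a : G) (X Y), form (Ad E a X) (Ad E a Y) = form X Y

instance instLieGroupMinSmoothness [LieGroup 𝓘(ℝ, E) ∞ G] :
    LieGroup 𝓘(ℝ, E) (minSmoothness ℝ 3) G :=
  LieGroup.of_le (n := ∞) (by
    rw [minSmoothness_of_isRCLikeNormedField]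
    exact WithTop.coe_le_coe.2 le_top)

/-- `𝔪 = 𝔥^⊥`, the orthogonal complement of `𝔥` with respect to `Q`. -/
def isotropyModule (Q : BiinvariantMetric E G) (H : Subgroup G) :
    Submodule ℝ (GroupLieAlgebra 𝓘(ℝ, E) G) :=
  LinearMap.BilinForm.orthogonal Q.form (subgroupLieAlgebra E H)

theorem mem_isotropyModule {Q : BiinvariantMetric E G} {H : Subgroup G}
    {Y : GroupLieAlgebra 𝓘(ℝ, E) G} :
    Y ∈ isotropyModule Q H ↔ ∀ X ∈ subgroupLieAlgebra E H, Q.form X Y = 0 :=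
  Iff.rfl

instance instFiniteDimensionalLieAlgebra [FiniteDimensional ℝ E] :
    FiniteDimensional ℝ (GroupLieAlgebra 𝓘(ℝ, E) G) :=
  inferInstanceAs (FiniteDimensional ℝ E)

/-- The `Q`-orthogonal splitting `𝔤 = 𝔪 ⊕ 𝔥`. -/
theorem isCompl_isotropyModule [FiniteDimensional ℝ E]
    (Q : BiinvariantMetric E G) (H : Subgroup G) :
    IsCompl (isotropyModule Q H) (subgroupLieAlgebra E H) := by
  have hrefl : Q.form.IsRefl := fun X Y h => by rw [Q.symm, h]
  refine (LinearMap.BilinForm.isCompl_orthogonal_iff_disjoint hrefl).2 ?_ |>.symm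
  rw [Submodule.disjoint_def]
  intro X hX hX'
  by_contra hne
  exact (Q.pos X hne).ne' (hX' X hX)

section Conj
variable [LieGroup 𝓘(ℝ, E) ∞ G]

theorem mdifferentiable_conj (a : G) :
    MDifferentiable 𝓘(ℝ, E) 𝓘(ℝ, E) (fun x : G => a * x * a⁻¹) := by
  have h : ContMDiff 𝓘(ℝ, E) 𝓘(ℝ, E) ∞ (fun x : G => a * x * a⁻¹) :=
    (contMDiff_mul_right (a := a⁻¹)).comp (contMDiff_mul_left (a := a))
  exact h.mdifferentiable (by simp)

theorem hasMFDerivAt_conj (a : G) {x : G} (hx : x = 1) :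
    HasMFDerivAt 𝓘(ℝ, E) 𝓘(ℝ, E) (fun x : G => a * x * a⁻¹) x
      (mfderiv 𝓘(ℝ, E) 𝓘(ℝ, E) (fun x : G => a * x * a⁻¹) 1 : E →L[ℝ] E) := by
  subst hx
  exact (mdifferentiable_conj a 1).hasMFDerivAt

theorem Ad_Ad_inv (a : G) (X : GroupLieAlgebra 𝓘(ℝ, E) G) : Ad E a (Ad E a⁻¹ X) = X := by
  have h := HasMFDerivAt.comp (1 : G) (hasMFDerivAt_conj (E := E) a (by simp))
    (hasMFDerivAt_conj (E := E) a⁻¹ rfl)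
  have hid : ((fun x : G => a * x * a⁻¹) ∘ fun x : G => a⁻¹ * x * a⁻¹⁻¹) = id := by
    funext x
    simp [mul_assoc]
  rw [hid] at h
  exact congrArg (fun L : E →L[ℝ] E => L X)
    (hasMFDerivAt_unique h (hasMFDerivAt_id (I := 𝓘(ℝ, E)) (1 : G)))

theorem IsVelocity.Ad {H : Subgroup G} {X : GroupLieAlgebra 𝓘(ℝ, E) G} (hX : IsVelocity H X)
    {a : G} (ha : a ∈ H) : IsVelocity H (Ad E a X) := by
  obtain ⟨γ, hγ, h0, hd⟩ := hX
  refine ⟨fun t => a * γ t * a⁻¹, fun t => H.mul_mem (H.mul_mem ha (hγ t)) (H.inv_mem ha),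
    by simp [h0], ?_⟩
  have h := HasMFDerivAt.comp (0 : ℝ) (hasMFDerivAt_conj (E := E) a h0) hd
  have key : ∀ (L : E →L[ℝ] E) (x : E), L.comp (ContinuousLinearMap.toSpanSingleton ℝ x) =
      ContinuousLinearMap.toSpanSingleton ℝ (L x) := fun L x => by ext; simp
  exact h.congr_mfderiv (key _ _)

theorem Ad_mem_subgroupLieAlgebra {H : Subgroup G} {a : G} (ha : a ∈ H)
    {X : GroupLieAlgebra 𝓘(ℝ, E) G} (hX : X ∈ subgroupLieAlgebra E H) :
    Ad E a X ∈ subgroupLieAlgebra E H := by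
  have h : subgroupLieAlgebra E H ≤ (subgroupLieAlgebra E H).comap (Ad E a) :=
    Submodule.span_le.2 fun Y hY => Submodule.subset_span (IsVelocity.Ad hY ha)
  exact h hX

theorem Ad_mem_isotropyModule {Q : BiinvariantMetric E G} {H : Subgroup G} {a : G} (ha : a ∈ H)
    {Y : GroupLieAlgebra 𝓘(ℝ, E) G} (hY : Y ∈ isotropyModule Q H) :
    Ad E a Y ∈ isotropyModule Q H := by
  rw [mem_isotropyModule] at hY ⊢
  intro X hX
  rw [← Ad_Ad_inv a X, Q.invariant]
  exact hY _ (Ad_mem_subgroupLieAlgebra (H.inv_mem ha) hX)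

end Conj

end Group

/-! ### The curvature of a homogeneous metric

`V` stands for the tangent space `𝔪` at the base point, `b X Y = [X, Y]_𝔪` for the `𝔪`-component
of the bracket and `r X Y Z = [[X, Y]_𝔥, Z]` for the action of its `𝔥`-component. -/

section Curvature

variable {V : Type*} [NormedAddCommGroup V] [NormedSpace ℝ V]

/-- Bilinear forms on `V`, normed by the operator norm. -/
abbrev Form2 (V : Type*) [NormedAddCommGroup V] [NormedSpace ℝ V] : Type _ := V →L[ℝ] V →L[ℝ] ℝ

/-- The endomorphism `g⁻¹ A` of `V`, characterized by `g ((g⁻¹ A) u) v = A u v`. -/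
def raise (g A : Form2 V) : V →ₗ[ℝ] V :=
  ((ContinuousLinearMap.inverse g).comp A).toLinearMap

/-- The trace `tr_g A` of a bilinear form with respect to the inner product `g`. -/
def traceWrt (g A : Form2 V) : ℝ := LinearMap.trace ℝ V (raise g A)

/-- The inner product `⟨A, B⟩_g = tr (g⁻¹ A g⁻¹ B)` of symmetric bilinear forms induced by `g`. -/
def innerWrt (g A B : Form2 V) : ℝ := LinearMap.trace ℝ V (raise g A ∘ₗ raise g B)

variable [FiniteDimensional ℝ V]

/-- The right-hand side of the Koszul formula:
`Z ↦ ½ (g([X,Y]_𝔪, Z) + g([Z,X]_𝔪, Y) + g(X, [Z,Y]_𝔪))`. -/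
def koszul (b : V →ₗ[ℝ] V →ₗ[ℝ] V) (g : Form2 V) (X Y : V) : V →L[ℝ] ℝ :=
  LinearMap.toContinuousLinearMap
    { toFun := fun Z => (1 / 2 : ℝ) * (g (b X Y) Z + g (b Z X) Y + g X (b Z Y))
      map_add' := fun Z W => by
        simp only [map_add, LinearMap.add_apply, add_apply]
        ring
      map_smul' := fun c Z => by
        simp only [map_smul, LinearMap.smul_apply, smul_apply, smul_eq_mul,
          RingHom.id_apply]
        ring }

theorem koszul_apply (b : V →ₗ[ℝ] V →ₗ[ℝ] V) (g : Form2 V) (X Y Z : V) :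
    koszul b g X Y Z = (1 / 2 : ℝ) * (g (b X Y) Z + g (b Z X) Y + g X (b Z Y)) :=
  rfl

/-- The Levi-Civita connection of the homogeneous metric `g` at the base point, as the bilinear map
`Λ(X) Y` with `g(Λ(X) Y, Z) = ½ (g([X,Y]_𝔪, Z) + g([Z,X]_𝔪, Y) + g(X, [Z,Y]_𝔪))`. -/
def leviCivita (b : V →ₗ[ℝ] V →ₗ[ℝ] V) (g : Form2 V) : V →ₗ[ℝ] V →ₗ[ℝ] V :=
  LinearMap.mk₂ ℝ (fun X Y => ContinuousLinearMap.inverse g (koszul b g X Y))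
    (fun X X' Y => by
      rw [← map_add]
      congr 1
      ext Z
      simp only [koszul_apply, map_add, LinearMap.add_apply, add_apply]
      ring)
    (fun c X Y => by
      rw [← map_smul]
      congr 1
      ext Z
      simp only [koszul_apply, map_smul, LinearMap.smul_apply, smul_apply,
        smul_eq_mul]
      ring)
    (fun X Y Y' => by
      rw [← map_add]
      congr 1
      ext Z
      simp only [koszul_apply, map_add, add_apply]
      ring)
    (fun c X Y => by
      rw [← map_smul]
      congr 1
      ext Z
      simp only [koszul_apply, map_smul, smul_apply,
        smul_eq_mul]
      ring)

/-- The map `X ↦ R(X, Y) Z` for the curvature tensor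
`R(X, Y) Z = Λ(X) Λ(Y) Z - Λ(Y) Λ(X) Z - Λ([X,Y]_𝔪) Z - [[X,Y]_𝔥, Z]`. -/
def curvature (b : V →ₗ[ℝ] V →ₗ[ℝ] V) (r : V →ₗ[ℝ] V →ₗ[ℝ] V →ₗ[ℝ] V) (g : Form2 V)
    (Y Z : V) : V →ₗ[ℝ] V where
  toFun X := leviCivita b g X (leviCivita b g Y Z) - leviCivita b g Y (leviCivita b g X Z)
    - leviCivita b g (b X Y) Z - r X Y Z
  map_add' X X' := by
    simp only [map_add, LinearMap.add_apply]
    abel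
  map_smul' c X := by
    simp only [map_smul, LinearMap.smul_apply, RingHom.id_apply, smul_sub]

/-- The Ricci tensor `Ric(Y, Z) = tr (X ↦ R(X, Y) Z)`. -/
def ricciForm (b : V →ₗ[ℝ] V →ₗ[ℝ] V) (r : V →ₗ[ℝ] V →ₗ[ℝ] V →ₗ[ℝ] V) (g : Form2 V) :
    Form2 V :=
  LinearMap.toContinuousBilinearMap <|
    LinearMap.mk₂ ℝ (fun Y Z => LinearMap.trace ℝ V (curvature b r g Y Z))
      (fun Y Y' Z => by
        rw [← map_add]
        congr 1
        ext X
        simp only [curvature, LinearMap.coe_mk, AddHom.coe_mk, map_add, LinearMap.add_apply]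
        abel)
      (fun c Y Z => by
        rw [← map_smul]
        congr 1
        ext X
        simp only [curvature, LinearMap.coe_mk, AddHom.coe_mk, map_smul, LinearMap.smul_apply,
          smul_sub])
      (fun Y Z Z' => by
        rw [← map_add]
        congr 1
        ext X
        simp only [curvature, LinearMap.coe_mk, AddHom.coe_mk, map_add, LinearMap.add_apply]
        abel)
      (fun c Y Z => by
        rw [← map_smul]
        congr 1
        ext X
        simp only [curvature, LinearMap.coe_mk, AddHom.coe_mk, map_smul, LinearMap.smul_apply,
          smul_sub])

end Curvature

/-! ### Homogeneous metrics on `G/H` -/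

section Metrics

variable {E : Type*} [NormedAddCommGroup E] [NormedSpace ℝ E]
  {G : Type*} [TopologicalSpace G] [ChartedSpace E G] [Group G]

/-- The tangent space of `G/H` at the base point, i.e. `𝔪`, as a Euclidean space with the inner
product `Q`. -/
def IsotropySpace (Q : BiinvariantMetric E G) (H : Subgroup G) : Type _ :=
  ↥(isotropyModule Q H)

/-- The restriction of `Q` to `𝔪`. -/
@[reducible]
def isotropyCore (Q : BiinvariantMetric E G) (H : Subgroup G) :
    InnerProductSpace.Core ℝ ↥(isotropyModule Q H) where
  inner X Y := Q.form X Y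
  conj_inner_symm X Y := Q.symm Y X
  re_inner_nonneg X := by
    by_cases h : X = 0
    · simp [h]
    · exact (Q.pos X (fun h' => h (Subtype.ext h'))).le
  add_left X Y Z := by simp
  smul_left X Y c := by simp
  definite X hX := by
    by_contra h
    exact (Q.pos X (fun h' => h (Subtype.ext h'))).ne' hX

variable (Q : BiinvariantMetric E G) (H : Subgroup G)

instance instNormedAddCommGroupIsotropySpace : NormedAddCommGroup (IsotropySpace Q H) :=
  (isotropyCore Q H).toNormedAddCommGroup

instance instInnerProductSpaceIsotropySpace : InnerProductSpace ℝ (IsotropySpace Q H) :=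
  InnerProductSpace.ofCore (isotropyCore Q H).toCore

/-- The inclusion `𝔪 → 𝔤`. -/
def incl : IsotropySpace Q H →ₗ[ℝ] GroupLieAlgebra 𝓘(ℝ, E) G :=
  (isotropyModule Q H).subtype

variable [FiniteDimensional ℝ E]

instance instFiniteDimensionalIsotropySpace : FiniteDimensional ℝ (IsotropySpace Q H) :=
  inferInstanceAs (FiniteDimensional ℝ ↥(isotropyModule Q H))

/-- The projection `X ↦ X_𝔪` of `𝔤` onto `𝔪` along `𝔥`. -/
def proj : GroupLieAlgebra 𝓘(ℝ, E) G →ₗ[ℝ] IsotropySpace Q H :=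
  Submodule.projectionOnto _ _ (isCompl_isotropyModule Q H)

variable [LieGroup 𝓘(ℝ, E) ∞ G]

/-- The isotropy representation of `H` on `𝔪`: the restriction of `Ad`. -/
def isotropyRep (a : H) : IsotropySpace Q H →ₗ[ℝ] IsotropySpace Q H :=
  (Ad E (a : G)).restrict (fun _ hY => Ad_mem_isotropyModule a.2 hY)

/-- `[X, Y]_𝔪` for `X, Y ∈ 𝔪`. -/
def bracketM : IsotropySpace Q H →ₗ[ℝ] IsotropySpace Q H →ₗ[ℝ] IsotropySpace Q H :=
  LinearMap.mk₂ ℝ (fun X Y => proj Q H ⁅incl Q H X, incl Q H Y⁆)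
    (by intros; simp only [map_add, add_lie])
    (by intros; simp only [map_smul, smul_lie])
    (by intros; simp only [map_add, lie_add])
    (by intros; simp only [map_smul, lie_smul])

/-- `[X, Y]_𝔥 ∈ 𝔥 ⊆ 𝔤` for `X, Y ∈ 𝔪`. -/
def bracketH (X Y : IsotropySpace Q H) : GroupLieAlgebra 𝓘(ℝ, E) G :=
  ⁅incl Q H X, incl Q H Y⁆ - incl Q H (bracketM Q H X Y)

/-- `[[X, Y]_𝔥, Z]` for `X, Y, Z ∈ 𝔪`; the projection to `𝔪` only records that this bracket,
which lies in `[𝔥, 𝔪] ⊆ 𝔪`, is regarded as an element of `𝔪`. -/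
def bracketHM :
    IsotropySpace Q H →ₗ[ℝ] IsotropySpace Q H →ₗ[ℝ] IsotropySpace Q H →ₗ[ℝ] IsotropySpace Q H :=
  LinearMap.mk₂ ℝ
    (fun X Y =>
      { toFun := fun Z => proj Q H ⁅bracketH Q H X Y, incl Q H Z⁆
        map_add' := by intros; simp only [map_add, lie_add]
        map_smul' := by intros; simp only [map_smul, lie_smul, RingHom.id_apply] })
    (by
      intros
      ext Z
      simp only [bracketH, LinearMap.coe_mk, AddHom.coe_mk, LinearMap.add_apply, map_add, add_lie,
        sub_lie, map_sub]
      abel_nf)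
    (by
      intros
      ext Z
      simp only [bracketH, LinearMap.coe_mk, AddHom.coe_mk, LinearMap.smul_apply, map_smul,
        smul_lie, sub_lie, map_sub, smul_sub])
    (by
      intros
      ext Z
      simp only [bracketH, LinearMap.coe_mk, AddHom.coe_mk, LinearMap.add_apply, map_add, lie_add,
        add_lie, sub_lie, map_sub]
      abel_nf)
    (by
      intros
      ext Z
      simp only [bracketH, LinearMap.coe_mk, AddHom.coe_mk, LinearMap.smul_apply, map_smul,
        lie_smul, smul_lie, sub_lie, map_sub, smul_sub])

/-- The space `𝒯` of `G`-invariant symmetric `(0,2)`-tensor fields on `G/H`: the symmetric bilinear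
forms on `𝔪` that are invariant under the isotropy representation. -/
def invariantTensors : Submodule ℝ (Form2 (IsotropySpace Q H)) where
  carrier := {A | (∀ u v, A u v = A v u) ∧
    ∀ (a : H) (u v), A (isotropyRep Q H a u) (isotropyRep Q H a v) = A u v}
  add_mem' := by
    rintro A B ⟨hA, hA'⟩ ⟨hB, hB'⟩
    exact ⟨fun u v => by simp [hA u v, hB u v], fun a u v => by simp [hA' a u v, hB' a u v]⟩
  zero_mem' := ⟨fun u v => by simp, fun a u v => by simp⟩
  smul_mem' := by
    rintro c A ⟨hA, hA'⟩
    exact ⟨fun u v => by simp [hA u v], fun a u v => by simp [hA' a u v]⟩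

variable {Q H}

/-- Positive definiteness of an invariant symmetric tensor. -/
def IsPosDef (A : invariantTensors Q H) : Prop :=
  ∀ u : IsotropySpace Q H, u ≠ 0 → 0 < (A : Form2 (IsotropySpace Q H)) u u

variable (Q H) in
/-- The space `𝓜` of `G`-invariant Riemannian metrics on `G/H`, i.e. of inner products on `𝔪` that
are invariant under the isotropy representation; an open subset of `𝒯`. -/
def metrics : Set (invariantTensors Q H) := {g | IsPosDef g}

/-- The Ricci curvature of the homogeneous metric `g`. -/
def ricci (g : invariantTensors Q H) : Form2 (IsotropySpace Q H) :=
  ricciForm (bracketM Q H) (bracketHM Q H) g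

/-- The scalar curvature `S(g) = tr_g Ric(g)`. -/
def scalarCurvature (g : invariantTensors Q H) : ℝ := traceWrt g.1 (ricci g)

/-- The hypersurface `𝓜_T = {g ∈ 𝓜 | tr_g T = 1}`. -/
def metricsT (T : invariantTensors Q H) : Set (invariantTensors Q H) :=
  {g | g ∈ metrics Q H ∧ traceWrt g.1 T.1 = 1}

/-- The differential `dRic_g` of the Ricci curvature `g ↦ Ric(g)`. -/
def dRicci (g : invariantTensors Q H) : invariantTensors Q H →L[ℝ] Form2 (IsotropySpace Q H) :=
  fderiv ℝ ricci g

end Metrics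

/-! ### Critical points and Hessians of a function restricted to a submanifold -/

section Morse

variable {W : Type*} [NormedAddCommGroup W] [NormedSpace ℝ W]

/-- `γ` is (near time `0`) a twice continuously differentiable curve in `N` with `γ 0 = p`. -/
def IsCurveIn (N : Set W) (p : W) (γ : ℝ → W) : Prop :=
  ContDiffAt ℝ 2 γ 0 ∧ γ 0 = p ∧ ∀ᶠ t in 𝓝 (0 : ℝ), γ t ∈ N

/-- The tangent space `T_p N` of a submanifold `N` of `W`: the velocities of curves in `N`. -/
def tangentSpaceOf (N : Set W) (p : W) : Submodule ℝ W :=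
  Submodule.span ℝ {v | ∃ γ, IsCurveIn N p γ ∧ deriv γ 0 = v}

/-- `p` is a critical point of the restriction of `f` to `N`. -/
def IsCriticalPt (f : W → ℝ) (N : Set W) (p : W) : Prop :=
  p ∈ N ∧ ∀ γ, IsCurveIn N p γ → HasDerivAt (f ∘ γ) 0 0

/-- `B` is the Hessian, at the critical point `p`, of the restriction of `f` to `N`: the symmetric
bilinear form on `T_p N` with `(f ∘ γ)''(0) = B (γ'(0), γ'(0))` for every curve `γ` in `N` through
`p`. -/
def IsHessianAt (f : W → ℝ) (N : Set W) (p : W) (B : LinearMap.BilinForm ℝ (tangentSpaceOf N p)) :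
    Prop :=
  (∀ X Y, B X Y = B Y X) ∧
    ∀ γ, IsCurveIn N p γ → ∀ X : tangentSpaceOf N p, (X : W) = deriv γ 0 →
      ContDiffAt ℝ 2 (f ∘ γ) 0 ∧ iteratedDeriv 2 (f ∘ γ) 0 = B X X

/-- `p` is a non-degenerate critical point of the restriction of `f` to `N`. -/
def IsNondegenerateCriticalPt (f : W → ℝ) (N : Set W) (p : W) : Prop :=
  IsCriticalPt f N p ∧ ∃ B, IsHessianAt f N p B ∧ ∀ X, (∀ Y, B X Y = 0) → X = 0

/-- The restriction of `f` to `N` is a Morse function: smooth, with all critical points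
non-degenerate. -/
def IsMorseOn (f : W → ℝ) (N : Set W) : Prop :=
  (∀ p ∈ N, ContDiffAt ℝ ∞ f p) ∧ ∀ p, IsCriticalPt f N p → IsNondegenerateCriticalPt f N p

end Morse

end HomSpace

end

open HomSpace

/-! The whole proposition rests on the first variation formula `dS_g(X) = -⟨Ric(g), X⟩_g`.
Differentiating `S = tr_g Ric` gives `tr_g(dRic_g X) - ⟨Ric(g), X⟩_g`, and the first term vanishes
(`traceWrt_fderiv_ricciForm`): `ad` is skew for `Q`, so the space is unimodular and `Ric` is
`-tr(Λ(·)Y ∘ Λ(·)Z)` plus a term independent of the metric (`ricciForm_eq`). The variation of the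
connection `Λ` is symmetric because the torsion is fixed, while each `Λ(X)` is `g`-skew, and the
contraction of the two is zero.

Since `d(tr_g T)(X) = -⟨T, X⟩_g`, the tangent space of `𝓜_T` is `T^⊥` and the critical points are
the solutions of `Ric(g) = cT` (`isCriticalPt_iff`). With `c` as Lagrange multiplier, `F = S - c
tr_g T` satisfies `dF_h = -⟨Ric(h) - cT, ·⟩_h` at every metric `h`. At the critical point `Ric(g) -
cT` is zero, so the second derivative only sees `dRic_g`, which is statement 1.

For statement 2, `dRic_g(X)` is orthogonal to `g`, and `⟨T, g⟩_g = 1` gives `𝒯 = T^⊥ ⊕ ℝg`. Hence a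
null vector of the Hessian is killed by `dRic_g`. As `g` lies in the kernel of `dRic_g` by scaling,
injectivity on `T^⊥` means that this kernel is exactly `ℝg`.

For statement 3, Sard's theorem is applied to `Ψ(h) = tr_Q(h) Ric(h)`, which is homogeneous of
degree one: a solution of `Ric(g) = cT` with `c > 0` can be rescaled to a preimage of `T`, and if
`T` is a regular value the kernel of `dRic_g` is `ℝg` (`ae_ker_eq_span`). That `c > 0` at every
critical point follows from `tr_Q Ric(g) > 0` (`traceWrt_ricci_pos`). In a basis diagonalizing `g`
and `Q` together this is Schur's inequality for the eigenvalues, with equality excluded because `𝔪`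
is not central. -/

set_option linter.unusedSectionVars false

noncomputable section

namespace HomSpace

/-! ### The adjoint action and the Lie bracket -/

section LocalGroup

variable {E : Type*} [NormedAddCommGroup E] [NormedSpace ℝ E] [CompleteSpace E]

/-- In a local group `m` with unit `e`, if `A x` satisfies `(A x Y) · x = x · Y` infinitesimally,
then the derivative of `x ↦ A x Y` at `e` is the Lie bracket of the left-invariant vector fields. -/
theorem hasFDerivAt_localAd {m : E × E → E} {e : E} (hm : ContDiffAt ℝ 2 m (e, e))
    (h1 : ∀ᶠ x in 𝓝 e, m (x, e) = x) (h2 : ∀ᶠ y in 𝓝 e, m (e, y) = y) {Y : E} {A : E → E}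
    (hA : ∀ᶠ x in 𝓝 e, fderiv ℝ m (e, x) (A x, 0) = fderiv ℝ m (x, e) (0, Y)) :
    HasFDerivAt A (fderiv ℝ (fun x => fderiv ℝ m (x, e) (0, Y)) e -
      (fderiv ℝ (fun y => fderiv ℝ m y) (e, e)).flip (Y, 0) ∘L
        ContinuousLinearMap.inr ℝ E E) e ∧ 
    ∀ X, fderiv ℝ (fun y => fderiv ℝ m y) (e, e) (0, X) (Y, 0) =
      fderiv ℝ (fun x => fderiv ℝ m (x, e) (0, X)) e Y := by
  have hd : DifferentiableAt ℝ (fun y => fderiv ℝ m y) (e, e) :=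
    (hm.fderiv_right (m := 1) (by norm_num)).differentiableAt (by norm_num)
  have hl : HasFDerivAt (fun x : E => (x, e)) (ContinuousLinearMap.inl ℝ E E) e :=
    hasFDerivAt_prodMk_left e e
  have hr : HasFDerivAt (fun x : E => (e, x)) (ContinuousLinearMap.inr ℝ E E) e :=
    hasFDerivAt_prodMk_right e e
  have hV : ∀ Z : E, HasFDerivAt (fun x => fderiv ℝ m (x, e) (0, Z))
      ((fderiv ℝ (fun y => fderiv ℝ m y) (e, e)).flip (0, Z) ∘L ContinuousLinearMap.inl ℝ E E)
      e := fun Z => by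
    have h := (HasFDerivAt.comp (f := fun x : E => (x, e)) e hd.hasFDerivAt hl).clm_apply
      (hasFDerivAt_const ((0 : E), Z) e)
    refine h.congr_fderiv ?_
    ext X
    simp
  have hP : HasFDerivAt (fun x => fderiv ℝ m (e, x) ∘L ContinuousLinearMap.inl ℝ E E)
      (((ContinuousLinearMap.compL ℝ E (E × E) E).flip (ContinuousLinearMap.inl ℝ E E)) ∘L
        (fderiv ℝ (fun y => fderiv ℝ m y) (e, e) ∘L ContinuousLinearMap.inr ℝ E E)) e :=
    (((ContinuousLinearMap.compL ℝ E (E × E) E).flip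
      (ContinuousLinearMap.inl ℝ E E)).hasFDerivAt).comp e (hd.hasFDerivAt.comp e hr)
  have hme : HasFDerivAt m (fderiv ℝ m (e, e)) (e, e) :=
    (hm.differentiableAt (by norm_num)).hasFDerivAt
  have hPe : fderiv ℝ m (e, e) ∘L ContinuousLinearMap.inl ℝ E E = ContinuousLinearMap.id ℝ E :=
    ((HasFDerivAt.comp (f := fun x : E => (x, e)) e hme hl).congr_of_eventuallyEq
      (h1.mono fun x hx => hx.symm)).unique
      (hasFDerivAt_id e)
  have hVe : ∀ Z, fderiv ℝ m (e, e) (0, Z) = Z := fun Z => by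
    have h : fderiv ℝ m (e, e) ∘L ContinuousLinearMap.inr ℝ E E = ContinuousLinearMap.id ℝ E :=
      ((hme.comp e hr).congr_of_eventuallyEq (h2.mono fun x hx => hx.symm)).unique
        (hasFDerivAt_id e)
    simpa using congrArg (fun L : E →L[ℝ] E => L Z) h
  -- The first partial derivative of `m` at `(e, x)` is the identity at `x = e`, so the derivative
  -- of its inverse there is minus its own derivative.
  have hinv : HasFDerivAt (fun x => Ring.inverse
      (fderiv ℝ m (e, x) ∘L ContinuousLinearMap.inl ℝ E E : E →L[ℝ] E)) 
      (-(((ContinuousLinearMap.compL ℝ E (E × E) E).flip (ContinuousLinearMap.inl ℝ E E)) ∘L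
        (fderiv ℝ (fun y => fderiv ℝ m y) (e, e) ∘L ContinuousLinearMap.inr ℝ E E))) e := by
    have h0 := hasFDerivAt_ringInverse (𝕜 := ℝ) (1 : (E →L[ℝ] E)ˣ)
    have hPe' : fderiv ℝ m (e, e) ∘L ContinuousLinearMap.inl ℝ E E =
      ((1 : (E →L[ℝ] E)ˣ) : E →L[ℝ] E) := hPe
    rw [← hPe'] at h0
    refine (h0.comp e hP).congr_fderiv ?_
    ext X Z
    simp
  constructor
  · have h := hinv.clm_apply (hV Y)
    -- Near `e` that partial derivative is still invertible, so the implicit equation for `A` can be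
    -- solved and the product rule applies.
    have hev : A =ᶠ[𝓝 e] fun x => Ring.inverse
        (fderiv ℝ m (e, x) ∘L ContinuousLinearMap.inl ℝ E E : E →L[ℝ] E)
          (fderiv ℝ m (x, e) (0, Y)) := by
      have hu : ∀ᶠ x in 𝓝 e, IsUnit
          (fderiv ℝ m (e, x) ∘L ContinuousLinearMap.inl ℝ E E : E →L[ℝ] E) := by
        have h0 : IsUnit (fderiv ℝ m (e, e) ∘L ContinuousLinearMap.inl ℝ E E : E →L[ℝ] E) := by
          rw [hPe]; exact isUnit_one
        exact hP.continuousAt.eventually (Units.isOpen.mem_nhds h0)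
      filter_upwards [hu, hA] with x hx hAx
      have h1 : (fderiv ℝ m (e, x) ∘L ContinuousLinearMap.inl ℝ E E) (A x) =
        fderiv ℝ m (x, e) (0, Y) := by simpa using hAx
      rw [← h1, ← mul_apply_eq_comp, Ring.inverse_mul_cancel _ hx]
      rfl
    refine (h.congr_of_eventuallyEq hev).congr_fderiv ?_
    rw [(hV Y).fderiv]
    ext X
    have : Ring.inverse (fderiv ℝ m (e, e) ∘L ContinuousLinearMap.inl ℝ E E : E →L[ℝ] E) = 1 := by
      rw [hPe]; exact Ring.inverse_one _
    simp [this, hVe, sub_eq_add_neg]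
  · intro X
    rw [(hV X).fderiv]
    -- Symmetry of the second derivative of `m` turns the mixed derivative into the derivative of a
    -- left-invariant field, so the two conclusions together give a commutator of fields.
    have hs := hm.isSymmSndFDerivAt (by simp)
    simpa using hs.eq (0, X) (Y, 0)

end LocalGroup

/-! ### The adjoint action and the Lie bracket in the chart at the identity. -/

section Group

variable {E : Type*} [NormedAddCommGroup E] [NormedSpace ℝ E] [FiniteDimensional ℝ E]
  {G : Type*} [TopologicalSpace G] [ChartedSpace E G] [Group G] [LieGroup 𝓘(ℝ, E) ∞ G]

/-- The Lie algebra is modelled on `E`. -/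
def toModel : GroupLieAlgebra 𝓘(ℝ, E) G ≃ₗ[ℝ] E := LinearEquiv.refl ℝ E

variable (E G) in
/-- The multiplication of `G` in the chart at `1`. -/
def chartMul : E × E → E := fun p =>
  extChartAt 𝓘(ℝ, E) (1 : G) ((extChartAt 𝓘(ℝ, E) (1 : G)).symm p.1 *
    (extChartAt 𝓘(ℝ, E) (1 : G)).symm p.2)

variable (E G) in
/-- The point of the chart at `1` that corresponds to `1`. -/
def chartOne : E := extChartAt 𝓘(ℝ, E) (1 : G) 1

theorem extChartAt_symm_chartOne : (extChartAt 𝓘(ℝ, E) (1 : G)).symm (chartOne E G) = 1 :=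
  extChartAt_to_inv (I := 𝓘(ℝ, E)) (1 : G)

theorem eventually_mem_target :
    ∀ᶠ x in 𝓝 (chartOne E G), x ∈ (extChartAt 𝓘(ℝ, E) (1 : G)).target :=
  extChartAt_target_mem_nhds (I := 𝓘(ℝ, E)) (1 : G)

theorem eventually_chartMul_left : ∀ᶠ x in 𝓝 (chartOne E G),
    chartMul E G (x, chartOne E G) = x := by
  filter_upwards [eventually_mem_target] with x hx
  simp only [chartMul, extChartAt_symm_chartOne, mul_one]
  exact (extChartAt 𝓘(ℝ, E) (1 : G)).right_inv hx

theorem eventually_chartMul_right : ∀ᶠ x in 𝓝 (chartOne E G),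
    chartMul E G (chartOne E G, x) = x := by
  filter_upwards [eventually_mem_target] with x hx
  simp only [chartMul, extChartAt_symm_chartOne, one_mul]
  exact (extChartAt 𝓘(ℝ, E) (1 : G)).right_inv hx

theorem contMDiffAt_symm_chartOne :
    ContMDiffAt 𝓘(ℝ, E) 𝓘(ℝ, E) ∞ (extChartAt 𝓘(ℝ, E) (1 : G)).symm (chartOne E G) :=
  (contMDiffOn_extChartAt_symm (I := 𝓘(ℝ, E)) (n := ∞) (1 : G)).contMDiffAt
    eventually_mem_target

theorem contDiffAt_chartMul :
    ContDiffAt ℝ ∞ (chartMul E G) (chartOne E G, chartOne E G) := by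
  rw [← contMDiffAt_iff_contDiffAt]
  have ha : ContMDiffAt 𝓘(ℝ, E × E) 𝓘(ℝ, E) ∞
      (fun p : E × E => (extChartAt 𝓘(ℝ, E) (1 : G)).symm p.1) (chartOne E G, chartOne E G) :=
    ContMDiffAt.comp (I' := 𝓘(ℝ, E)) (chartOne E G, chartOne E G) contMDiffAt_symm_chartOne
      contDiff_fst.contMDiff.contMDiffAt
  have hb : ContMDiffAt 𝓘(ℝ, E × E) 𝓘(ℝ, E) ∞
      (fun p : E × E => (extChartAt 𝓘(ℝ, E) (1 : G)).symm p.2) (chartOne E G, chartOne E G) :=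
    ContMDiffAt.comp (I' := 𝓘(ℝ, E)) (chartOne E G, chartOne E G) contMDiffAt_symm_chartOne
      contDiff_snd.contMDiff.contMDiffAt
  have hc := ha.mul hb
  refine ContMDiffAt.comp (I' := 𝓘(ℝ, E)) (chartOne E G, chartOne E G) ?_ hc
  have : (extChartAt 𝓘(ℝ, E) (1 : G)).symm (chartOne E G) *
    (extChartAt 𝓘(ℝ, E) (1 : G)).symm (chartOne E G) = 1 := by
    rw [extChartAt_symm_chartOne, one_mul]
  simp only [this]
  exact contMDiffAt_extChartAt

theorem hasMFDerivAt_symm_chartOne :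
    HasMFDerivAt 𝓘(ℝ, E) 𝓘(ℝ, E) (extChartAt 𝓘(ℝ, E) (1 : G)).symm (chartOne E G)
      (ContinuousLinearMap.id ℝ E) := by
  have h := (contMDiffAt_symm_chartOne (E := E) (G := G)).mdifferentiableAt (by simp)
  refine h.hasMFDerivAt.congr_mfderiv ?_
  have h2 := mfderivWithin_range_extChartAt_symm (I := 𝓘(ℝ, E)) (x := (1 : G))
  rw [ModelWithCorners.range_eq_univ, mfderivWithin_univ] at h2
  exact h2

/-- The derivative at `1` of a function on `G`, read in the chart. -/
theorem hasFDerivAt_comp_symm {f : G → E} {L : E →L[ℝ] E}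
    (hf : HasMFDerivAt 𝓘(ℝ, E) 𝓘(ℝ, E) f 1 L) :
    HasFDerivAt (fun x => f ((extChartAt 𝓘(ℝ, E) (1 : G)).symm x)) L (chartOne E G) := by
  have hf' : HasMFDerivAt 𝓘(ℝ, E) 𝓘(ℝ, E) f
      ((extChartAt 𝓘(ℝ, E) (1 : G)).symm (chartOne E G)) L := by
    rw [extChartAt_symm_chartOne]; exact hf
  exact (hf'.comp (chartOne E G) hasMFDerivAt_symm_chartOne).hasFDerivAt

theorem eventually_differentiableAt_chartMul :
    ∀ᶠ x in 𝓝 (chartOne E G), DifferentiableAt ℝ (chartMul E G) (x, chartOne E G) ∧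
      DifferentiableAt ℝ (chartMul E G) (chartOne E G, x) := by
  have h := ((contDiffAt_chartMul (E := E) (G := G)).of_le (m := 1) (by simp)).eventually
    (by simp)
  have hl : Filter.Tendsto (fun x : E => (x, chartOne E G)) (𝓝 (chartOne E G))
      (𝓝 (chartOne E G, chartOne E G)) := by
    have : Continuous (fun x : E => (x, chartOne E G)) := by fun_prop
    exact this.tendsto _
  have hr : Filter.Tendsto (fun x : E => (chartOne E G, x)) (𝓝 (chartOne E G))
      (𝓝 (chartOne E G, chartOne E G)) := by
    have : Continuous (fun x : E => (chartOne E G, x)) := by fun_prop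
    exact this.tendsto _
  filter_upwards [hl.eventually h, hr.eventually h] with x h1 h2
  exact ⟨h1.differentiableAt (by simp), h2.differentiableAt (by simp)⟩

theorem mdifferentiableAt_chart {x : E} (hx : x ∈ (extChartAt 𝓘(ℝ, E) (1 : G)).target) :
    MDifferentiableAt 𝓘(ℝ, E) 𝓘(ℝ, E) (extChartAt 𝓘(ℝ, E) (1 : G))
      ((extChartAt 𝓘(ℝ, E) (1 : G)).symm x) := by
  apply mdifferentiableAt_extChartAt
  rw [← extChartAt_source 𝓘(ℝ, E)]
  exact (extChartAt 𝓘(ℝ, E) (1 : G)).map_target hx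

/-- The derivative of left translation, read in the chart at `1`. -/
theorem fderiv_chartMul_right {x : E}
    (hd : DifferentiableAt ℝ (chartMul E G) (x, chartOne E G)) {L : E →L[ℝ] E}
    (hL : HasMFDerivAt 𝓘(ℝ, E) 𝓘(ℝ, E) (fun z : G => extChartAt 𝓘(ℝ, E) (1 : G)
      ((extChartAt 𝓘(ℝ, E) (1 : G)).symm x * z)) 1 L) (Z : E) :
    fderiv ℝ (chartMul E G) (x, chartOne E G) (0, Z) = L Z := by
  have h := HasFDerivAt.comp (f := fun y : E => (x, y)) (chartOne E G) hd.hasFDerivAt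
    (hasFDerivAt_prodMk_right x (chartOne E G))
  simpa using congrArg (fun L : E →L[ℝ] E => L Z) (h.unique (hasFDerivAt_comp_symm hL))

/-- The derivative of right translation, read in the chart at `1`. -/
theorem fderiv_chartMul_left {x : E}
    (hd : DifferentiableAt ℝ (chartMul E G) (chartOne E G, x)) {L : E →L[ℝ] E}
    (hL : HasMFDerivAt 𝓘(ℝ, E) 𝓘(ℝ, E) (fun z : G => extChartAt 𝓘(ℝ, E) (1 : G)
      (z * (extChartAt 𝓘(ℝ, E) (1 : G)).symm x)) 1 L) (Z : E) :
    fderiv ℝ (chartMul E G) (chartOne E G, x) (Z, 0) = L Z := by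
  have h := HasFDerivAt.comp (f := fun y : E => (y, x)) (chartOne E G) hd.hasFDerivAt
    (hasFDerivAt_prodMk_left (chartOne E G) x)
  simpa using congrArg (fun L : E →L[ℝ] E => L Z) (h.unique (hasFDerivAt_comp_symm hL))

theorem hasMFDerivAt_chart_mul_left {x : E} (hx : x ∈ (extChartAt 𝓘(ℝ, E) (1 : G)).target) :
    HasMFDerivAt 𝓘(ℝ, E) 𝓘(ℝ, E) (fun z : G => extChartAt 𝓘(ℝ, E) (1 : G)
      ((extChartAt 𝓘(ℝ, E) (1 : G)).symm x * z)) 1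
      ((mfderiv 𝓘(ℝ, E) 𝓘(ℝ, E) (extChartAt 𝓘(ℝ, E) (1 : G))
        ((extChartAt 𝓘(ℝ, E) (1 : G)).symm x) : E →L[ℝ] E) ∘L
        (mfderiv 𝓘(ℝ, E) 𝓘(ℝ, E) (fun z : G => (extChartAt 𝓘(ℝ, E) (1 : G)).symm x * z) 1 :
          E →L[ℝ] E)) := by
  have h1 : MDifferentiableAt 𝓘(ℝ, E) 𝓘(ℝ, E)
      (fun z : G => (extChartAt 𝓘(ℝ, E) (1 : G)).symm x * z) 1 :=
    (contMDiffAt_mul_left (I := 𝓘(ℝ, E)) (n := ∞)).mdifferentiableAt (by simp)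
  have h2 : HasMFDerivAt 𝓘(ℝ, E) 𝓘(ℝ, E) (extChartAt 𝓘(ℝ, E) (1 : G))
      ((extChartAt 𝓘(ℝ, E) (1 : G)).symm x * 1)
      (mfderiv 𝓘(ℝ, E) 𝓘(ℝ, E) (extChartAt 𝓘(ℝ, E) (1 : G))
        ((extChartAt 𝓘(ℝ, E) (1 : G)).symm x) : E →L[ℝ] E) := by
    rw [mul_one]; exact (mdifferentiableAt_chart hx).hasMFDerivAt
  exact h2.comp (1 : G) h1.hasMFDerivAt

theorem hasMFDerivAt_chart_mul_right {x : E} (hx : x ∈ (extChartAt 𝓘(ℝ, E) (1 : G)).target) :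
    HasMFDerivAt 𝓘(ℝ, E) 𝓘(ℝ, E) (fun z : G => extChartAt 𝓘(ℝ, E) (1 : G)
      (z * (extChartAt 𝓘(ℝ, E) (1 : G)).symm x)) 1
      ((mfderiv 𝓘(ℝ, E) 𝓘(ℝ, E) (extChartAt 𝓘(ℝ, E) (1 : G))
        ((extChartAt 𝓘(ℝ, E) (1 : G)).symm x) : E →L[ℝ] E) ∘L
        (mfderiv 𝓘(ℝ, E) 𝓘(ℝ, E) (fun z : G => z * (extChartAt 𝓘(ℝ, E) (1 : G)).symm x) 1 :
          E →L[ℝ] E)) := by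
  have h1 : MDifferentiableAt 𝓘(ℝ, E) 𝓘(ℝ, E)
      (fun z : G => z * (extChartAt 𝓘(ℝ, E) (1 : G)).symm x) 1 :=
    (contMDiffAt_mul_right (I := 𝓘(ℝ, E)) (n := ∞)).mdifferentiableAt (by simp)
  have h2 : HasMFDerivAt 𝓘(ℝ, E) 𝓘(ℝ, E) (extChartAt 𝓘(ℝ, E) (1 : G))
      (1 * (extChartAt 𝓘(ℝ, E) (1 : G)).symm x)
      (mfderiv 𝓘(ℝ, E) 𝓘(ℝ, E) (extChartAt 𝓘(ℝ, E) (1 : G))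
        ((extChartAt 𝓘(ℝ, E) (1 : G)).symm x) : E →L[ℝ] E) := by
    rw [one_mul]; exact (mdifferentiableAt_chart hx).hasMFDerivAt
  exact h2.comp (1 : G) h1.hasMFDerivAt

open VectorField in
/-- The left-invariant vector fields, read in the chart at `1`. -/
def chartField (Z : GroupLieAlgebra 𝓘(ℝ, E) G) : E → E :=
  mpullbackWithin 𝓘(ℝ, E) 𝓘(ℝ, E) (extChartAt 𝓘(ℝ, E) (1 : G)).symm
    (mulInvariantVectorField Z) (Set.range 𝓘(ℝ, E))

-- The pullback inverts the derivative of the inverse chart, which yields the derivative of the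
-- chart. What remains is the derivative of left translation, i.e. a partial derivative of
-- `chartMul`.
open VectorField in
theorem eventually_chartField (Z : GroupLieAlgebra 𝓘(ℝ, E) G) :
    chartField Z =ᶠ[𝓝 (chartOne E G)]
      fun x => fderiv ℝ (chartMul E G) (x, chartOne E G) (0, toModel Z) := by
  filter_upwards [eventually_mem_target (E := E) (G := G), eventually_differentiableAt_chartMul]
    with x hx hd
  refine Eq.trans ?_ (fderiv_chartMul_right hd.1 (hasMFDerivAt_chart_mul_left hx) _).symm
  have hinv : (mfderivWithin 𝓘(ℝ, E) 𝓘(ℝ, E) (extChartAt 𝓘(ℝ, E) (1 : G)).symm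
      (Set.range 𝓘(ℝ, E)) x).inverse = mfderiv 𝓘(ℝ, E) 𝓘(ℝ, E) (extChartAt 𝓘(ℝ, E) (1 : G))
        ((extChartAt 𝓘(ℝ, E) (1 : G)).symm x) :=
    ContinuousLinearMap.inverse_eq
      (mfderivWithin_extChartAt_symm_comp_mfderiv_extChartAt hx)
      (mfderiv_extChartAt_comp_mfderivWithin_extChartAt_symm hx)
  have h : chartField Z x = ((mfderivWithin 𝓘(ℝ, E) 𝓘(ℝ, E)
      (extChartAt 𝓘(ℝ, E) (1 : G)).symm (Set.range 𝓘(ℝ, E)) x).inverse : E →L[ℝ] E)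
      (mulInvariantVectorField Z ((extChartAt 𝓘(ℝ, E) (1 : G)).symm x)) := rfl
  rw [h, hinv]
  rfl

/-- Differentiate `(a z a⁻¹) a = a z` at `z = 1`. This supplies the implicit equation required by
`hasFDerivAt_localAd`. -/
theorem eventually_fderiv_chartMul_Ad (Y : GroupLieAlgebra 𝓘(ℝ, E) G) :
    ∀ᶠ x in 𝓝 (chartOne E G), fderiv ℝ (chartMul E G) (chartOne E G, x)
      (toModel (Ad E ((extChartAt 𝓘(ℝ, E) (1 : G)).symm x) Y), 0) =
      fderiv ℝ (chartMul E G) (x, chartOne E G) (0, toModel Y) := by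
  filter_upwards [eventually_mem_target (E := E) (G := G), eventually_differentiableAt_chartMul]
    with x hx hd
  refine (fderiv_chartMul_left hd.2 (hasMFDerivAt_chart_mul_right hx) _).trans
    (Eq.trans ?_ (fderiv_chartMul_right hd.1 (hasMFDerivAt_chart_mul_left hx) _).symm)
  set a := (extChartAt 𝓘(ℝ, E) (1 : G)).symm x with ha
  have hR := hasMFDerivAt_chart_mul_right hx
  rw [← ha] at hR
  have hR' : HasMFDerivAt 𝓘(ℝ, E) 𝓘(ℝ, E) (fun z : G => extChartAt 𝓘(ℝ, E) (1 : G) (z * a))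
      (a * 1 * a⁻¹)
      ((mfderiv 𝓘(ℝ, E) 𝓘(ℝ, E) (extChartAt 𝓘(ℝ, E) (1 : G)) a : E →L[ℝ] E) ∘L
        (mfderiv 𝓘(ℝ, E) 𝓘(ℝ, E) (fun z : G => z * a) 1 : E →L[ℝ] E)) := by
    have : a * 1 * a⁻¹ = 1 := by simp
    rw [this]; exact hR
  have h := hR'.comp (1 : G) (hasMFDerivAt_conj (E := E) a rfl)
  have hfun : ((fun z : G => extChartAt 𝓘(ℝ, E) (1 : G) (z * a)) ∘ fun x : G => a * x * a⁻¹) =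
      fun z => extChartAt 𝓘(ℝ, E) (1 : G) (a * z) := by
    funext z
    simp
  rw [hfun] at h
  exact congrArg (fun L : E →L[ℝ] E => L Y)
    (hasMFDerivAt_unique h (hasMFDerivAt_chart_mul_left hx))

-- The derivative of the chart at `1` is the identity, so the bracket is that of the fields in the
-- chart, and at the unit these fields take the values `X` and `Y`.
open VectorField in
theorem bracket_eq_chart (X Y : GroupLieAlgebra 𝓘(ℝ, E) G) :
    toModel ⁅X, Y⁆ =
      fderiv ℝ (fun x => fderiv ℝ (chartMul E G) (x, chartOne E G) (0, toModel Y))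
        (chartOne E G) (toModel X) -
      fderiv ℝ (fun x => fderiv ℝ (chartMul E G) (x, chartOne E G) (0, toModel X))
        (chartOne E G) (toModel Y) := by
  have hval : ∀ Z : E, fderiv ℝ (chartMul E G) (chartOne E G, chartOne E G) (0, Z) = Z := by
    intro Z
    have hd := (eventually_differentiableAt_chartMul (E := E) (G := G)).self_of_nhds.1
    have h := HasFDerivAt.comp (f := fun y : E => (chartOne E G, y)) (chartOne E G)
      hd.hasFDerivAt (hasFDerivAt_prodMk_right (chartOne E G) (chartOne E G))
    have h2 := (h.congr_of_eventuallyEq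
      (eventually_chartMul_right.mono fun x hx => hx.symm)).unique (hasFDerivAt_id _)
    simpa using congrArg (fun L : E →L[ℝ] E => L Z) h2
  let D : E →L[ℝ] E := mfderiv 𝓘(ℝ, E) 𝓘(ℝ, E) (extChartAt 𝓘(ℝ, E) (1 : G)) 1
  have hD : D = ContinuousLinearMap.id ℝ E := mfderiv_extChartAt_self
  have hset : ((extChartAt 𝓘(ℝ, E) (1 : G)).symm ⁻¹' Set.univ ∩ Set.range 𝓘(ℝ, E)) =
      Set.univ := by simp
  have hbr : toModel ⁅X, Y⁆ = D.inverse (lieBracketWithin ℝ (chartField X) (chartField Y)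
      ((extChartAt 𝓘(ℝ, E) (1 : G)).symm ⁻¹' Set.univ ∩ Set.range 𝓘(ℝ, E))
      (chartOne E G)) := rfl
  rw [hbr, hD, ContinuousLinearMap.inverse_id, hset, ContinuousLinearMap.id_apply,
    lieBracketWithin_univ]
  refine (Filter.EventuallyEq.lieBracket_vectorField_eq
    (eventually_chartField X) (eventually_chartField Y)).trans ?_
  simp only [lieBracket, hval]

/-- The derivative of the adjoint action along a curve through `1` is the Lie bracket with the
velocity of the curve. -/
theorem hasDerivAt_Ad {γ : ℝ → G} (h0 : γ 0 = 1) {X : GroupLieAlgebra 𝓘(ℝ, E) G}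
    (hd : HasMFDerivAt 𝓘(ℝ, ℝ) 𝓘(ℝ, E) γ 0
      (ContinuousLinearMap.toSpanSingleton ℝ (X : E) : ℝ →L[ℝ] E))
    (Y : GroupLieAlgebra 𝓘(ℝ, E) G) :
    HasDerivAt (fun t => toModel (Ad E (γ t) Y)) (toModel ⁅X, Y⁆) 0 := by
  have h1 : HasMFDerivAt 𝓘(ℝ, E) 𝓘(ℝ, E) (extChartAt 𝓘(ℝ, E) (1 : G)) (γ 0)
      (ContinuousLinearMap.id ℝ E) := by
    rw [h0]
    refine (mdifferentiableAt_extChartAt (I := 𝓘(ℝ, E)) (mem_chart_source E (1 : G))).hasMFDerivAt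
      |>.congr_mfderiv ?_
    exact mfderiv_extChartAt_self
  have h2 : HasFDerivAt (fun t => extChartAt 𝓘(ℝ, E) (1 : G) (γ t))
      (ContinuousLinearMap.toSpanSingleton ℝ (toModel X) : ℝ →L[ℝ] E) 0 :=
    (h1.comp (0 : ℝ) hd).hasFDerivAt
  have h3 := (hasFDerivAt_localAd ((contDiffAt_chartMul (E := E) (G := G)).of_le
    (WithTop.coe_le_coe.2 le_top))
    eventually_chartMul_left eventually_chartMul_right (eventually_fderiv_chartMul_Ad Y))
  have h4 : HasFDerivAt (fun t => toModel (Ad E ((extChartAt 𝓘(ℝ, E) (1 : G)).symm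
      (extChartAt 𝓘(ℝ, E) (1 : G) (γ t))) Y)) _ 0 :=
    HasFDerivAt.comp (g := fun x => toModel (Ad E ((extChartAt 𝓘(ℝ, E) (1 : G)).symm x) Y))
      (f := fun t => extChartAt 𝓘(ℝ, E) (1 : G) (γ t)) (0 : ℝ) (by
        have : extChartAt 𝓘(ℝ, E) (1 : G) (γ 0) = chartOne E G := by rw [h0]; rfl
        rw [this]; exact h3.1) h2
  have hev : (fun t => toModel (Ad E (γ t) Y)) =ᶠ[𝓝 0] fun t =>
      toModel (Ad E ((extChartAt 𝓘(ℝ, E) (1 : G)).symm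
        (extChartAt 𝓘(ℝ, E) (1 : G) (γ t))) Y) := by
    have hc : ContinuousAt γ 0 := hd.continuousAt
    have hs : (extChartAt 𝓘(ℝ, E) (1 : G)).source ∈ 𝓝 (γ 0) := by
      rw [h0]; exact extChartAt_source_mem_nhds (1 : G)
    filter_upwards [hc hs] with t ht
    rw [(extChartAt 𝓘(ℝ, E) (1 : G)).left_inv ht]
  have h5 := (h4.congr_of_eventuallyEq hev).hasDerivAt
  refine h5.congr_deriv ?_
  rw [bracket_eq_chart, ← h3.2]
  simp

end Group

section LinearAlgebra

theorem isInvertible_of_injective {V W : Type*} [NormedAddCommGroup V] [NormedSpace ℝ V]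
    [NormedAddCommGroup W] [NormedSpace ℝ W] [FiniteDimensional ℝ V] [FiniteDimensional ℝ W]
    (h : Module.finrank ℝ V = Module.finrank ℝ W) {L : V →L[ℝ] W}
    (hL : Function.Injective L) : L.IsInvertible :=
  ⟨(LinearEquiv.ofInjectiveOfFinrankEq L.toLinearMap hL h).toContinuousLinearEquiv, by ext; rfl⟩

end LinearAlgebra

/-! ### Automorphism property of the adjoint action and infinitesimal invariance of forms. -/

section Group

variable {E : Type*} [NormedAddCommGroup E] [NormedSpace ℝ E] [FiniteDimensional ℝ E]
  {G : Type*} [TopologicalSpace G] [ChartedSpace E G] [Group G] [LieGroup 𝓘(ℝ, E) ∞ G]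

theorem Ad_one (X : GroupLieAlgebra 𝓘(ℝ, E) G) : Ad E (1 : G) X = X := by
  have hid : (fun x : G => 1 * x * 1⁻¹) = id := by
    funext x
    simp
  have h : Ad E (1 : G) X =
    (mfderiv 𝓘(ℝ, E) 𝓘(ℝ, E) (fun x : G => 1 * x * 1⁻¹) 1 : E →L[ℝ] E) X := rfl
  rw [h, hid]
  exact congrArg (fun L : E →L[ℝ] E => L X) (mfderiv_id (I := 𝓘(ℝ, E)) (x := (1 : G)))

theorem isInvertible_mfderiv_conj (a z : G) :
    (mfderiv 𝓘(ℝ, E) 𝓘(ℝ, E) (fun x : G => a * x * a⁻¹) z : E →L[ℝ] E).IsInvertible := by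
  refine isInvertible_of_injective (V := E) (W := E) rfl ?_
  have h := HasMFDerivAt.comp z (mdifferentiable_conj (E := E) a⁻¹ (a * z * a⁻¹)).hasMFDerivAt
    (mdifferentiable_conj (E := E) a z).hasMFDerivAt
  have hid : ((fun x : G => a⁻¹ * x * a⁻¹⁻¹) ∘ fun x : G => a * x * a⁻¹) = id := by
    funext x
    simp [mul_assoc]
  rw [hid] at h
  have h2 : ∀ X : E, (mfderiv 𝓘(ℝ, E) 𝓘(ℝ, E) (fun x : G => a⁻¹ * x * a⁻¹⁻¹) (a * z * a⁻¹) :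
      E →L[ℝ] E) ((mfderiv 𝓘(ℝ, E) 𝓘(ℝ, E) (fun x : G => a * x * a⁻¹) z : E →L[ℝ] E) X) = X :=
    fun X => congrArg (fun L : E →L[ℝ] E => L X)
      (hasMFDerivAt_unique h (hasMFDerivAt_id (I := 𝓘(ℝ, E)) z))
  exact Function.LeftInverse.injective h2

-- Differentiate `a (z x) a⁻¹ = (a z a⁻¹)(a x a⁻¹)` at `x = 1`: conjugation carries left
-- translations to left translations.
open VectorField in
theorem mpullback_conj_mulInvariantVectorField (a : G) (X : GroupLieAlgebra 𝓘(ℝ, E) G) :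
    mpullback 𝓘(ℝ, E) 𝓘(ℝ, E) (fun x : G => a * x * a⁻¹) (mulInvariantVectorField (Ad E a X)) =
      mulInvariantVectorField X := by
  funext z
  have hz : ∀ w : G, MDifferentiableAt 𝓘(ℝ, E) 𝓘(ℝ, E) (fun x : G => w * x) 1 := fun w =>
    (contMDiffAt_mul_left (I := 𝓘(ℝ, E)) (n := ∞)).mdifferentiableAt (by simp)
  have h1 : HasMFDerivAt 𝓘(ℝ, E) 𝓘(ℝ, E) (fun x : G => a * x * a⁻¹) (z * 1)
      (mfderiv 𝓘(ℝ, E) 𝓘(ℝ, E) (fun x : G => a * x * a⁻¹) z : E →L[ℝ] E) := by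
    rw [mul_one]; exact (mdifferentiable_conj (E := E) a z).hasMFDerivAt
  have h2 : HasMFDerivAt 𝓘(ℝ, E) 𝓘(ℝ, E) (fun x : G => a * z * a⁻¹ * x) (a * 1 * a⁻¹)
      (mfderiv 𝓘(ℝ, E) 𝓘(ℝ, E) (fun x : G => a * z * a⁻¹ * x) 1 : E →L[ℝ] E) := by
    have : a * 1 * a⁻¹ = 1 := by simp
    rw [this]; exact (hz _).hasMFDerivAt
  have e1 := h1.comp (1 : G) (hz z).hasMFDerivAt
  have e2 := h2.comp (1 : G) (hasMFDerivAt_conj (E := E) a rfl)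
  have hfun : ((fun x : G => a * x * a⁻¹) ∘ fun x : G => z * x) =
      ((fun x : G => a * z * a⁻¹ * x) ∘ fun x : G => a * x * a⁻¹) := by
    funext x
    simp [mul_assoc]
  rw [hfun] at e1
  have e3 : (mfderiv 𝓘(ℝ, E) 𝓘(ℝ, E) (fun x : G => a * x * a⁻¹) z : E →L[ℝ] E)
      (mulInvariantVectorField X z : E) = (mulInvariantVectorField (Ad E a X) (a * z * a⁻¹) : E) :=
    congrArg (fun L : E →L[ℝ] E => L X) (hasMFDerivAt_unique e1 e2)
  have e4 : (mpullback 𝓘(ℝ, E) 𝓘(ℝ, E) (fun x : G => a * x * a⁻¹)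
      (mulInvariantVectorField (Ad E a X)) z : E) =
      (mfderiv 𝓘(ℝ, E) 𝓘(ℝ, E) (fun x : G => a * x * a⁻¹) z : E →L[ℝ] E).inverse
        (mulInvariantVectorField (Ad E a X) (a * z * a⁻¹) : E) := rfl
  refine e4.trans ?_
  rw [← e3]
  exact (isInvertible_mfderiv_conj a z).inverse_apply_self _

open VectorField in
/-- The adjoint action is by automorphisms of the Lie algebra. -/
theorem Ad_lie (a : G) (X Y : GroupLieAlgebra 𝓘(ℝ, E) G) :
    Ad E a ⁅X, Y⁆ = ⁅Ad E a X, Ad E a Y⁆ := by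
  -- The bracket of vector fields is natural under pullback by conjugation; evaluating at the fixed
  -- point `1` gives the claim.
  have h := mpullback_mlieBracket (n := minSmoothness ℝ 3) (f := fun x : G => a * x * a⁻¹)
    (I := 𝓘(ℝ, E)) (I' := 𝓘(ℝ, E))
    (V := mulInvariantVectorField (Ad E a X)) (W := mulInvariantVectorField (Ad E a Y))
    (x₀ := (1 : G)) (mdifferentiableAt_mulInvariantVectorField _)
    (mdifferentiableAt_mulInvariantVectorField _)
    (((contMDiff_mul_right (a := a⁻¹)).comp (contMDiff_mul_left (a := a))).contMDiffAt)
    (minSmoothness_monotone (by norm_cast))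
  rw [mpullback_conj_mulInvariantVectorField, mpullback_conj_mulInvariantVectorField] at h
  have h2 : ∀ z : G, z = 1 → (mlieBracket 𝓘(ℝ, E) (mulInvariantVectorField (Ad E a X))
      (mulInvariantVectorField (Ad E a Y)) z : E) = toModel ⁅Ad E a X, Ad E a Y⁆ := by
    rintro z rfl
    rfl
  have h3 : (mfderiv 𝓘(ℝ, E) 𝓘(ℝ, E) (fun x : G => a * x * a⁻¹) 1 : E →L[ℝ] E).inverse
      (mlieBracket 𝓘(ℝ, E) (mulInvariantVectorField (Ad E a X))
      (mulInvariantVectorField (Ad E a Y)) (a * 1 * a⁻¹) : E) = toModel ⁅X, Y⁆ := h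
  rw [h2 _ (by simp)] at h3
  have h4 : toModel (E := E) (Ad E a ⁅X, Y⁆) = (mfderiv 𝓘(ℝ, E) 𝓘(ℝ, E) (fun x : G => a * x * a⁻¹) 1 :
    E →L[ℝ] E) (toModel (E := E) (G := G) ⁅X, Y⁆) := rfl
  apply toModel.injective
  rw [h4, ← h3]
  exact (isInvertible_mfderiv_conj a 1).self_apply_inverse _

/-- Every element of the Lie algebra is the velocity of a curve in `G`. -/
theorem exists_curve (X : GroupLieAlgebra 𝓘(ℝ, E) G) : IsVelocity (⊤ : Subgroup G) X := by
  refine ⟨fun t => (extChartAt 𝓘(ℝ, E) (1 : G)).symm (chartOne E G + t • toModel X),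
    fun t => Subgroup.mem_top _, ?_, ?_⟩
  · simp only [zero_smul, add_zero, extChartAt_symm_chartOne]
  · have h1 : HasFDerivAt (fun t : ℝ => chartOne E G + t • toModel X)
        (ContinuousLinearMap.toSpanSingleton ℝ (toModel X)) 0 := by
      have := ((hasDerivAt_id (0 : ℝ)).smul_const (toModel X)).const_add (chartOne E G)
      simpa [hasDerivAt_iff_hasFDerivAt] using this
    have h2 : HasMFDerivAt 𝓘(ℝ, E) 𝓘(ℝ, E) (extChartAt 𝓘(ℝ, E) (1 : G)).symm
        (chartOne E G + (0 : ℝ) • toModel X) (ContinuousLinearMap.id ℝ E) := by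
      rw [zero_smul, add_zero]; exact hasMFDerivAt_symm_chartOne
    exact h2.comp (0 : ℝ) h1.hasMFDerivAt

/-- Differentiating a bilinear form along the adjoint action. -/
theorem hasDerivAt_form_Ad {γ : ℝ → G} (h0 : γ 0 = 1) {X : GroupLieAlgebra 𝓘(ℝ, E) G}
    (hd : HasMFDerivAt 𝓘(ℝ, ℝ) 𝓘(ℝ, E) γ 0
      (ContinuousLinearMap.toSpanSingleton ℝ (X : E) : ℝ →L[ℝ] E))
    (B : LinearMap.BilinForm ℝ (GroupLieAlgebra 𝓘(ℝ, E) G))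
    (Y Z : GroupLieAlgebra 𝓘(ℝ, E) G) :
    HasDerivAt (fun t => B (Ad E (γ t) Y) (Ad E (γ t) Z)) (B ⁅X, Y⁆ Z + B Y ⁅X, Z⁆) 0 := by
  let B' : E →L[ℝ] E →L[ℝ] ℝ := LinearMap.toContinuousBilinearMap
    (B.compl₁₂ (toModel (G := G)).symm.toLinearMap (toModel (G := G)).symm.toLinearMap)
  have hB : ∀ Y Z, B' (toModel Y) (toModel Z) = B Y Z := fun Y Z => by simp [B']
  have h := (B'.hasFDerivAt.comp_hasDerivAt (0 : ℝ) (hasDerivAt_Ad h0 hd Y)).clm_apply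
    (hasDerivAt_Ad h0 hd Z)
  simp only [Function.comp_def, hB, h0, Ad_one] at h
  exact h

/-- Along a curve in `H` the pairing is constant, so its derivative vanishes; linearity in `X`
extends this from velocities to their span. Neither symmetry nor non-degeneracy of `B` is needed, so
the lemma serves for `Q`, for invariant tensors pulled back along `proj`, and for the one-sided form
in `lie_mem_isotropyModule`. -/
theorem lie_skew_of_forall_Ad {H : Subgroup G} {B : LinearMap.BilinForm ℝ (GroupLieAlgebra 𝓘(ℝ, E) G)}
    {Y Z : GroupLieAlgebra 𝓘(ℝ, E) G}
    (hB : ∀ a ∈ H, B (Ad E a Y) (Ad E a Z) = B Y Z) {X : GroupLieAlgebra 𝓘(ℝ, E) G}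
    (hX : X ∈ subgroupLieAlgebra E H) : B ⁅X, Y⁆ Z + B Y ⁅X, Z⁆ = 0 := by
  induction hX using Submodule.span_induction with
  | mem X hX =>
    obtain ⟨γ, hγ, h0, hd⟩ := hX
    have h := hasDerivAt_form_Ad h0 hd B Y Z
    simp only [hB _ (hγ _)] at h
    exact h.unique (hasDerivAt_const _ _)
  | zero => simp
  | add X X' _ _ h h' =>
    simp only [add_lie, map_add, LinearMap.add_apply]
    linear_combination h + h'
  | smul c X _ h =>
    simp only [smul_lie, map_smul, LinearMap.smul_apply, smul_eq_mul]
    linear_combination c * h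

theorem BiinvariantMetric.form_lie (Q : BiinvariantMetric E G)
    (X Y Z : GroupLieAlgebra 𝓘(ℝ, E) G) : Q.form ⁅X, Y⁆ Z + Q.form Y ⁅X, Z⁆ = 0 :=
  lie_skew_of_forall_Ad (H := ⊤) (fun a _ => Q.invariant a Y Z)
    (Submodule.subset_span (exists_curve X))

end Group

/-! ### The algebra of a homogeneous space -/

section Isotropy

variable {E : Type*} [NormedAddCommGroup E] [NormedSpace ℝ E] [FiniteDimensional ℝ E]
  {G : Type*} [TopologicalSpace G] [ChartedSpace E G] [Group G]
  {Q : BiinvariantMetric E G} {H : Subgroup G}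

theorem inner_eq_form (u v : IsotropySpace Q H) :
    inner ℝ u v = Q.form (incl Q H u) (incl Q H v) := rfl

theorem incl_mem (u : IsotropySpace Q H) : incl Q H u ∈ isotropyModule Q H := u.2

theorem proj_incl (u : IsotropySpace Q H) : proj Q H (incl Q H u) = u :=
  Submodule.projectionOnto_apply_left (isCompl_isotropyModule Q H) u

theorem proj_of_mem {Z : GroupLieAlgebra 𝓘(ℝ, E) G} (hZ : Z ∈ subgroupLieAlgebra E H) :
    proj Q H Z = 0 :=
  (Submodule.projectionOnto_apply_eq_zero_iff (isCompl_isotropyModule Q H)).2 hZ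

theorem sub_incl_proj_mem (Z : GroupLieAlgebra 𝓘(ℝ, E) G) :
    Z - incl Q H (proj Q H Z) ∈ subgroupLieAlgebra E H := by
  refine (Submodule.projectionOnto_apply_eq_zero_iff (isCompl_isotropyModule Q H)).1 ?_
  change proj Q H (Z - incl Q H (proj Q H Z)) = 0
  rw [map_sub, proj_incl, sub_self]

theorem form_of_mem {Z : GroupLieAlgebra 𝓘(ℝ, E) G} (hZ : Z ∈ subgroupLieAlgebra E H)
    (u : IsotropySpace Q H) : Q.form Z (incl Q H u) = 0 :=
  mem_isotropyModule.1 (incl_mem u) Z hZ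

theorem form_incl_proj (Z : GroupLieAlgebra 𝓘(ℝ, E) G) (u : IsotropySpace Q H) :
    Q.form (incl Q H (proj Q H Z)) (incl Q H u) = Q.form Z (incl Q H u) := by
  have h := form_of_mem (sub_incl_proj_mem (Q := Q) Z) u
  rw [map_sub, LinearMap.sub_apply] at h
  linarith

variable [LieGroup 𝓘(ℝ, E) ∞ G]

theorem bracketM_apply (X Y : IsotropySpace Q H) :
    bracketM Q H X Y = proj Q H ⁅incl Q H X, incl Q H Y⁆ := rfl

theorem bracketHM_apply (X Y Z : IsotropySpace Q H) :
    bracketHM Q H X Y Z = proj Q H ⁅bracketH Q H X Y, incl Q H Z⁆ := rfl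

theorem bracketH_mem (X Y : IsotropySpace Q H) : bracketH Q H X Y ∈ subgroupLieAlgebra E H :=
  sub_incl_proj_mem _

theorem incl_bracketM_add_bracketH (X Y : IsotropySpace Q H) :
    incl Q H (bracketM Q H X Y) + bracketH Q H X Y = ⁅incl Q H X, incl Q H Y⁆ := by
  simp [bracketH]

theorem bracketM_skew (X Y : IsotropySpace Q H) : bracketM Q H X Y = -bracketM Q H Y X := by
  rw [bracketM_apply, bracketM_apply, ← lie_skew, map_neg]

theorem bracketH_skew (X Y : IsotropySpace Q H) : bracketH Q H X Y = -bracketH Q H Y X := by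
  simp only [bracketH]
  rw [bracketM_skew X Y, ← lie_skew, map_neg]
  abel

theorem bracketHM_skew (X Y Z : IsotropySpace Q H) :
    bracketHM Q H X Y Z = -bracketHM Q H Y X Z := by
  rw [bracketHM_apply, bracketHM_apply, bracketH_skew, neg_lie, map_neg]

theorem bracketM_bracketM_add (X Y Z : IsotropySpace Q H) :
    bracketM Q H (bracketM Q H X Y) Z + bracketHM Q H X Y Z =
      proj Q H ⁅⁅incl Q H X, incl Q H Y⁆, incl Q H Z⁆ := by
  rw [bracketM_apply _ Z, bracketHM_apply, ← map_add, ← add_lie, incl_bracketM_add_bracketH]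

/-- The `𝔪`-component of the Jacobi identity. -/
theorem bracket_jacobi (X Y Z : IsotropySpace Q H) :
    (bracketM Q H (bracketM Q H X Y) Z + bracketHM Q H X Y Z) +
    (bracketM Q H (bracketM Q H Y Z) X + bracketHM Q H Y Z X) +
    (bracketM Q H (bracketM Q H Z X) Y + bracketHM Q H Z X Y) = 0 := by
  rw [bracketM_bracketM_add, bracketM_bracketM_add, bracketM_bracketM_add, ← map_add, ← map_add]
  have h := lie_jacobi (incl Q H X) (incl Q H Y) (incl Q H Z)
  rw [← lie_skew (incl Q H X) ⁅_, _⁆, ← lie_skew (incl Q H Y) ⁅_, _⁆,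
    ← lie_skew (incl Q H Z) ⁅_, _⁆] at h
  have h2 : ⁅⁅incl Q H X, incl Q H Y⁆, incl Q H Z⁆ + ⁅⁅incl Q H Y, incl Q H Z⁆, incl Q H X⁆ +
      ⁅⁅incl Q H Z, incl Q H X⁆, incl Q H Y⁆ = 0 := by
    rw [← neg_eq_zero, ← h]
    abel
  rw [h2, map_zero]

/-- Invariance of `Q`, projected to `𝔪`. Together with `bracketM_skew` it makes `Q([X, Y]_𝔪, Z)`
totally antisymmetric. -/
theorem inner_bracketM (X Y Z : IsotropySpace Q H) :
    inner ℝ (bracketM Q H X Y) Z = -inner ℝ Y (bracketM Q H X Z) := by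
  have h := Q.form_lie (incl Q H X) (incl Q H Y) (incl Q H Z)
  rw [inner_eq_form, inner_eq_form, bracketM_apply, bracketM_apply, form_incl_proj, Q.symm _
    (incl Q H (proj Q H _)), form_incl_proj, Q.symm _ (incl Q H Y)]
  linarith

/-- Move `Z` across by invariance of `Q`; the `𝔪`-part of `[Z, W]` drops out since `𝔥 ⊥ 𝔪`. For `Z =
Y`, `W = X` the result is minus the square norm of `[X, Y]_𝔥`, whose sign and vanishing are used for
the positivity of the Ricci trace. -/
theorem inner_bracketHM (X Y Z W : IsotropySpace Q H) :
    inner ℝ (bracketHM Q H X Y Z) W = Q.form (bracketH Q H X Y) (bracketH Q H Z W) := by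
  have h := Q.form_lie (incl Q H Z) (bracketH Q H X Y) (incl Q H W)
  rw [inner_eq_form, bracketHM_apply, form_incl_proj, ← lie_skew, map_neg, LinearMap.neg_apply]
  have h2 : Q.form (bracketH Q H X Y) (incl Q H (bracketM Q H Z W)) = 0 :=
    form_of_mem (bracketH_mem X Y) _
  rw [← incl_bracketM_add_bracketH, map_add, h2, zero_add] at h
  linarith

theorem coe_isotropyRep (a : H) (u : IsotropySpace Q H) :
    incl Q H (isotropyRep Q H a u) = Ad E (a : G) (incl Q H u) := rfl

theorem proj_Ad (a : H) (Z : GroupLieAlgebra 𝓘(ℝ, E) G) :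
    proj Q H (Ad E (a : G) Z) = isotropyRep Q H a (proj Q H Z) := by
  have h : Ad E (a : G) Z = incl Q H (isotropyRep Q H a (proj Q H Z)) +
      Ad E (a : G) (Z - incl Q H (proj Q H Z)) := by
    rw [coe_isotropyRep, map_sub]
    abel
  rw [h, map_add, proj_incl,
    proj_of_mem (Ad_mem_subgroupLieAlgebra a.2 (sub_incl_proj_mem (Q := Q) Z)), add_zero]

theorem isotropyRep_bracketM (a : H) (X Y : IsotropySpace Q H) :
    isotropyRep Q H a (bracketM Q H X Y) =
      bracketM Q H (isotropyRep Q H a X) (isotropyRep Q H a Y) := by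
  rw [bracketM_apply, bracketM_apply, ← proj_Ad, Ad_lie, coe_isotropyRep, coe_isotropyRep]

theorem Ad_bracketH (a : H) (X Y : IsotropySpace Q H) :
    Ad E (a : G) (bracketH Q H X Y) =
      bracketH Q H (isotropyRep Q H a X) (isotropyRep Q H a Y) := by
  rw [bracketH, bracketH, map_sub, Ad_lie, ← isotropyRep_bracketM, coe_isotropyRep,
    coe_isotropyRep, coe_isotropyRep]

theorem isotropyRep_bracketHM (a : H) (X Y Z : IsotropySpace Q H) :
    isotropyRep Q H a (bracketHM Q H X Y Z) =
      bracketHM Q H (isotropyRep Q H a X) (isotropyRep Q H a Y) (isotropyRep Q H a Z) := by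
  rw [bracketHM_apply, bracketHM_apply, ← proj_Ad, Ad_lie, Ad_bracketH, coe_isotropyRep]

theorem isotropyRep_isotropyRep_inv (a : H) (u : IsotropySpace Q H) :
    isotropyRep Q H a (isotropyRep Q H a⁻¹ u) = u :=
  Subtype.ext (Ad_Ad_inv (a : G) (incl Q H u))

variable (Q) in
/-- The isotropy representation, as linear automorphisms. -/
def isotropyEquiv (a : H) : IsotropySpace Q H ≃ₗ[ℝ] IsotropySpace Q H :=
  LinearEquiv.ofLinearMap (isotropyRep Q H a) (isotropyRep Q H a⁻¹)
    (LinearMap.ext fun u => isotropyRep_isotropyRep_inv a u)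
    (LinearMap.ext fun u => by simpa using isotropyRep_isotropyRep_inv a⁻¹ u)

/-- The isotropy algebra acts on `𝔪` by skew-symmetric maps for any invariant form. -/
theorem invariant_bracketHM {g : Form2 (IsotropySpace Q H)} (hg : g ∈ invariantTensors Q H)
    (X Y Z W : IsotropySpace Q H) :
    g (bracketHM Q H X Y Z) W + g Z (bracketHM Q H X Y W) = 0 := by
  let B : LinearMap.BilinForm ℝ (GroupLieAlgebra 𝓘(ℝ, E) G) :=
    LinearMap.mk₂ ℝ (fun U U' => g (proj Q H U) (proj Q H U')) (by simp) (by simp) (by simp)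
      (by simp)
  have hB : ∀ U U', B U U' = g (proj Q H U) (proj Q H U') := fun _ _ => rfl
  have h := lie_skew_of_forall_Ad (H := H) (B := B) (Y := incl Q H Z) (Z := incl Q H W)
    (fun a ha => by
      rw [hB, hB, proj_Ad ⟨a, ha⟩, proj_Ad ⟨a, ha⟩]
      exact hg.2 ⟨a, ha⟩ _ _) (bracketH_mem X Y)
  rw [hB, hB, proj_incl, proj_incl] at h
  exact h

/-- Infinitesimal form of the `Ad H`-invariance of `𝔪`. The auxiliary form `B(U, U') = Q(U_𝔥, U')`
vanishes when its first argument lies in `𝔪`, so its pairing with the orbit of `u` is constantly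
zero. -/
theorem lie_mem_isotropyModule {X : GroupLieAlgebra 𝓘(ℝ, E) G} (hX : X ∈ subgroupLieAlgebra E H)
    (u : IsotropySpace Q H) : ⁅X, incl Q H u⁆ ∈ isotropyModule Q H := by
  rw [mem_isotropyModule]
  intro Z hZ
  let B : LinearMap.BilinForm ℝ (GroupLieAlgebra 𝓘(ℝ, E) G) :=
    Q.form ∘ₗ (LinearMap.id - incl Q H ∘ₗ proj Q H)
  have hB : ∀ U U', B U U' = Q.form (U - incl Q H (proj Q H U)) U' := fun _ _ => rfl
  have h0 : ∀ (w : IsotropySpace Q H) U', B (incl Q H w) U' = 0 := fun w U' => by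
    rw [hB, proj_incl, sub_self, map_zero, LinearMap.zero_apply]
  have h := lie_skew_of_forall_Ad (H := H) (B := B) (Y := incl Q H u) (Z := Z)
    (fun a ha => by
      rw [← coe_isotropyRep ⟨a, ha⟩, h0, h0]) hX
  rw [h0, add_zero, hB, map_sub, LinearMap.sub_apply, Q.symm (incl Q H _), form_of_mem hZ,
    sub_zero, Q.symm] at h
  exact h

/-- If `[𝔪, 𝔪] = 0` then `𝔪` is central. -/
theorem lie_incl_eq_zero (hmm : ∀ v w : IsotropySpace Q H, ⁅incl Q H v, incl Q H w⁆ = 0) (Y : GroupLieAlgebra 𝓘(ℝ, E) G)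
    (u : IsotropySpace Q H) : ⁅Y, incl Q H u⁆ = 0 := by
  have hZ := sub_incl_proj_mem (Q := Q) (H := H) Y
  set Z := Y - incl Q H (proj Q H Y) with hZdef
  have hY : Y = incl Q H (proj Q H Y) + Z := by rw [hZdef]; abel
  rw [hY, add_lie, hmm, zero_add]
  by_contra hne
  obtain ⟨w, hw⟩ : ∃ w : IsotropySpace Q H, incl Q H w = ⁅Z, incl Q H u⁆ :=
    ⟨⟨_, lie_mem_isotropyModule hZ u⟩, rfl⟩
  -- With `w = [Z, u] ∈ 𝔪`, invariance turns `Q(w, w)` into a pairing of `Z` with `[u, w]`, which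
  -- lies in `[𝔪, 𝔪] = 0`.
  have h := Q.form_lie (incl Q H u) Z (incl Q H w)
  rw [hmm, map_zero, add_zero, ← lie_skew, map_neg, LinearMap.neg_apply, ← hw] at h
  have hpos := Q.pos _ hne
  rw [← hw] at hpos
  linarith

end Isotropy

/-! ### Inner products and traces -/

section Inner

variable {V : Type*} [NormedAddCommGroup V] [InnerProductSpace ℝ V] [FiniteDimensional ℝ V]

/-- Symmetric positive definite forms. -/
structure IsMetric (g : Form2 V) : Prop where
  symm : ∀ u v, g u v = g v u
  pos : ∀ u, u ≠ 0 → 0 < g u u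

variable {g : Form2 V}

theorem IsMetric.isInvertible (hg : IsMetric g) : g.IsInvertible := by
  refine isInvertible_of_injective ?_ ?_
  · rw [← (LinearMap.toContinuousLinearMap (𝕜 := ℝ) (E := V) (F' := ℝ)).finrank_eq]
    exact Subspace.dual_finrank_eq.symm
  · rw [injective_iff_map_eq_zero]
    intro u hu
    by_contra hne
    have := hg.pos u hne
    rw [hu] at this
    simp at this

theorem IsMetric.apply_inverse (hg : IsMetric g) (φ : V →L[ℝ] ℝ) :
    g (ContinuousLinearMap.inverse g φ) = φ := hg.isInvertible.self_apply_inverse φ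

theorem IsMetric.inverse_apply (hg : IsMetric g) (v : V) :
    ContinuousLinearMap.inverse g (g v) = v := hg.isInvertible.inverse_apply_self v

theorem IsMetric.ext (hg : IsMetric g) {u v : V} (h : ∀ w, g u w = g v w) : u = v := by
  rw [← hg.inverse_apply u, ← hg.inverse_apply v]
  congr 1
  ext w
  exact h w

theorem IsMetric.apply_raise (hg : IsMetric g) (A : Form2 V) (u v : V) :
    g (raise g A u) v = A u v := by
  change g (ContinuousLinearMap.inverse g (A u)) v = A u v
  rw [hg.apply_inverse]

/-- `e` is an orthonormal basis that diagonalizes `g`, with eigenvalues `x`. -/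
structure IsDiag (g : Form2 V) {n : ℕ} (e : OrthonormalBasis (Fin n) ℝ V) (x : Fin n → ℝ) :
    Prop where
  pos : ∀ i, 0 < x i
  left : ∀ i v, g (e i) v = x i * inner ℝ (e i) v
  right : ∀ i v, g v (e i) = x i * inner ℝ (e i) v

/-- Spectral theorem for the operator `P` representing `g` with respect to the Euclidean inner
product. -/
theorem IsMetric.exists_isDiag (hg : IsMetric g) :
    ∃ (e : OrthonormalBasis (Fin (Module.finrank ℝ V)) ℝ V) (x : Fin (Module.finrank ℝ V) → ℝ),
      IsDiag g e x := by
  let P : V →ₗ[ℝ] V :=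
    ((InnerProductSpace.toDual ℝ V).symm.toContinuousLinearEquiv.toContinuousLinearMap ∘L g :
      V →L[ℝ] V)
  have hP : ∀ u v, inner ℝ (P u) v = g u v := fun u v =>
    InnerProductSpace.toDual_symm_apply
  have hs : P.IsSymmetric := fun u v => by
    rw [hP, real_inner_comm, hP, hg.symm]
  have hl : ∀ i v, g (hs.eigenvectorBasis rfl i) v =
      hs.eigenvalues rfl i * inner ℝ (hs.eigenvectorBasis rfl i) v := fun i v => by
    rw [← hP, hs.apply_eigenvectorBasis rfl i]
    simp [inner_smul_left]
  refine ⟨hs.eigenvectorBasis rfl, hs.eigenvalues rfl, ?_, hl, fun i v => by rw [hg.symm, hl]⟩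
  intro i
  have h := hl i (hs.eigenvectorBasis rfl i)
  have hne : hs.eigenvectorBasis rfl i ≠ 0 := (hs.eigenvectorBasis rfl).orthonormal.ne_zero i
  have hpos := hg.pos _ hne
  rw [h, real_inner_self_eq_norm_sq, (hs.eigenvectorBasis rfl).orthonormal.1 i] at hpos
  simpa using hpos

variable (V) in
/-- The inner product of `V` as a bilinear form. -/
def euclideanForm : Form2 V := LinearMap.toContinuousBilinearMap (innerₗ V)

theorem euclideanForm_apply (u v : V) : euclideanForm V u v = inner ℝ u v := rfl

theorem isDiag_euclideanForm {n : ℕ} (e : OrthonormalBasis (Fin n) ℝ V) :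
    IsDiag (euclideanForm V) e (fun _ => 1) :=
  ⟨fun _ => one_pos, fun i v => by simp [euclideanForm_apply],
    fun i v => by simp [euclideanForm_apply, real_inner_comm]⟩

theorem isMetric_euclideanForm : IsMetric (euclideanForm V) :=
  ⟨fun u v => by simp [euclideanForm_apply, real_inner_comm],
    fun u hu => by
      rw [euclideanForm_apply, real_inner_self_eq_norm_sq]
      exact pow_pos (norm_pos_iff.2 hu) 2⟩

theorem trace_comp_eq_sum {n : ℕ} (e : OrthonormalBasis (Fin n) ℝ V) (A B : V →ₗ[ℝ] V) :
    LinearMap.trace ℝ V (A ∘ₗ B) =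
      ∑ i, ∑ j, inner ℝ (e i) (A (e j)) * inner ℝ (e j) (B (e i)) := by
  rw [LinearMap.trace_eq_sum_inner _ e]
  refine Finset.sum_congr rfl fun i _ => ?_
  have h : B (e i) = ∑ j, inner ℝ (e j) (B (e i)) • e j := (e.sum_repr' _).symm
  rw [LinearMap.comp_apply]
  conv_lhs => rw [h]
  simp only [map_sum, map_smul, inner_sum, inner_smul_right]
  exact Finset.sum_congr rfl fun j _ => mul_comm _ _

/-! ### Traces in a basis of eigenvectors. -/

section Diag

variable {n : ℕ} {e : OrthonormalBasis (Fin n) ℝ V} {x : Fin n → ℝ}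

theorem IsDiag.inner_eq (hd : IsDiag g e x) (i : Fin n) (v : V) :
    inner ℝ (e i) v = g v (e i) / x i := by
  rw [hd.right, mul_div_cancel_left₀ _ (hd.pos i).ne']

theorem IsDiag.inner_raise (hd : IsDiag g e x) (hg : IsMetric g) (A : Form2 V) (i j : Fin n) :
    inner ℝ (e i) (raise g A (e j)) = A (e j) (e i) / x i := by
  rw [hd.inner_eq, hg.apply_raise]

theorem IsDiag.traceWrt_eq (hd : IsDiag g e x) (hg : IsMetric g) (A : Form2 V) :
    traceWrt g A = ∑ i, A (e i) (e i) / x i := by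
  rw [traceWrt, LinearMap.trace_eq_sum_inner _ e]
  exact Finset.sum_congr rfl fun i _ => hd.inner_raise hg A i i

theorem IsDiag.innerWrt_eq (hd : IsDiag g e x) (hg : IsMetric g) (A B : Form2 V) :
    innerWrt g A B = ∑ i, ∑ j, A (e j) (e i) / x i * (B (e i) (e j) / x j) := by
  rw [innerWrt, trace_comp_eq_sum e]
  simp only [hd.inner_raise hg]

end Diag

theorem innerWrt_comm (g A B : Form2 V) : innerWrt g A B = innerWrt g B A :=
  LinearMap.trace_mul_comm ℝ _ _

theorem raise_add (g A B : Form2 V) : raise g (A + B) = raise g A + raise g B := by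
  ext u; simp [raise]

theorem raise_smul (c : ℝ) (g A : Form2 V) : raise g (c • A) = c • raise g A := by
  ext u; simp [raise]

theorem innerWrt_add_left (g A A' B : Form2 V) :
    innerWrt g (A + A') B = innerWrt g A B + innerWrt g A' B := by
  simp [innerWrt, raise_add, LinearMap.add_comp]

theorem innerWrt_smul_left (c : ℝ) (g A B : Form2 V) :
    innerWrt g (c • A) B = c * innerWrt g A B := by
  simp [innerWrt, raise_smul, LinearMap.smul_comp]

theorem innerWrt_add_right (g A B B' : Form2 V) :
    innerWrt g A (B + B') = innerWrt g A B + innerWrt g A B' := by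
  rw [innerWrt_comm, innerWrt_add_left, innerWrt_comm, innerWrt_comm g B']

theorem innerWrt_smul_right (c : ℝ) (g A B : Form2 V) :
    innerWrt g A (c • B) = c * innerWrt g A B := by
  rw [innerWrt_comm, innerWrt_smul_left, innerWrt_comm]

theorem traceWrt_add (g A B : Form2 V) : traceWrt g (A + B) = traceWrt g A + traceWrt g B := by
  simp [traceWrt, raise_add]

theorem traceWrt_smul (c : ℝ) (g A : Form2 V) : traceWrt g (c • A) = c * traceWrt g A := by
  simp [traceWrt, raise_smul]

theorem IsMetric.raise_self (hg : IsMetric g) : raise g g = LinearMap.id := by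
  ext u
  exact hg.inverse_apply u

theorem IsMetric.innerWrt_self_right (hg : IsMetric g) (A : Form2 V) :
    innerWrt g A g = traceWrt g A := by
  rw [innerWrt, hg.raise_self, LinearMap.comp_id, traceWrt]

theorem IsMetric.eq_zero_of_innerWrt_self (hg : IsMetric g) {A : Form2 V}
    (hA : ∀ u v, A u v = A v u) (h : innerWrt g A A = 0) : A = 0 := by
  obtain ⟨e, x, hd⟩ := hg.exists_isDiag
  rw [hd.innerWrt_eq hg] at h
  have hterm : ∀ i j, 0 ≤ A (e j) (e i) / x i * (A (e i) (e j) / x j) := fun i j => by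
    rw [hA (e j), div_mul_div_comm]
    exact div_nonneg (mul_self_nonneg _) (mul_pos (hd.pos i) (hd.pos j)).le
  rw [Finset.sum_eq_zero_iff_of_nonneg fun i _ => Finset.sum_nonneg fun j _ => hterm i j] at h
  have hz : ∀ i j, A (e i) (e j) = 0 := fun i j => by
    have h1 := h i (Finset.mem_univ i)
    rw [Finset.sum_eq_zero_iff_of_nonneg fun j _ => hterm i j] at h1
    have h2 := h1 j (Finset.mem_univ j)
    rw [hA (e j), div_mul_div_comm, div_eq_zero_iff] at h2
    rcases h2 with h2 | h2
    · simpa using h2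
    · exact absurd h2 (mul_pos (hd.pos i) (hd.pos j)).ne'
  apply ContinuousLinearMap.coe_injective
  refine e.toBasis.ext fun i => ?_
  apply ContinuousLinearMap.coe_injective
  refine e.toBasis.ext fun j => ?_
  simpa using hz i j

theorem IsMetric.trace_eq_zero_of_skew (hg : IsMetric g) {A : V →ₗ[ℝ] V}
    (hA : ∀ u v, g (A u) v + g u (A v) = 0) : LinearMap.trace ℝ V A = 0 := by
  obtain ⟨e, x, hd⟩ := hg.exists_isDiag
  rw [LinearMap.trace_eq_sum_inner _ e]
  refine Finset.sum_eq_zero fun i _ => ?_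
  have h := hA (e i) (e i)
  rw [hg.symm (e i)] at h
  rw [hd.inner_eq, show g (A (e i)) (e i) = 0 by linarith, zero_div]

theorem IsMetric.smul (hg : IsMetric g) {c : ℝ} (hc : 0 < c) : IsMetric (c • g) :=
  ⟨fun u v => by simp [hg.symm u v], fun u hu => by simpa using mul_pos hc (hg.pos u hu)⟩

theorem inverse_smul (g : Form2 V) (c : ℝ) (hc : c ≠ 0) (hg : IsMetric g) :
    ContinuousLinearMap.inverse (c • g) = c⁻¹ • ContinuousLinearMap.inverse g := by
  refine ContinuousLinearMap.inverse_eq ?_ ?_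
  · ext φ u
    simp [hg.apply_inverse, hc]
  · ext u
    simp [hg.inverse_apply, hc]

theorem IsMetric.traceWrt_smul_left (hg : IsMetric g) {c : ℝ} (hc : c ≠ 0) (A : Form2 V) :
    traceWrt (c • g) A = c⁻¹ * traceWrt g A := by
  have h : raise (c • g) A = c⁻¹ • raise g A := by
    ext u
    simp [raise, inverse_smul g c hc hg]
  rw [traceWrt, h, map_smul, traceWrt, smul_eq_mul]

/-- Positive definiteness is an open condition. -/
theorem IsMetric.eventually_pos (hg : IsMetric g) :
    ∀ᶠ h in 𝓝 g, ∀ u, u ≠ 0 → 0 < (h : Form2 V) u u := by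
  -- The constant is the least eigenvalue of `g` (any positive number in dimension zero); forms
  -- within distance `c` of `g` stay positive on non-zero vectors.
  obtain ⟨c, hc, hcg⟩ : ∃ c > 0, ∀ u, c * ‖u‖ ^ 2 ≤ g u u := by
    obtain ⟨e, x, hd⟩ := hg.exists_isDiag
    have hval : ∀ u, g u u = ∑ i, x i * inner ℝ (e i) u ^ 2 := fun u => by
      have h : u = ∑ j, inner ℝ (e j) u • e j := (e.sum_repr' _).symm
      have h1 : g u u = g (∑ j, inner ℝ (e j) u • e j) u := by rw [← h]
      rw [h1]
      simp only [map_sum, map_smul, sum_apply, smul_apply, hd.left,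
        smul_eq_mul]
      exact Finset.sum_congr rfl fun i _ => by ring
    have hnorm : ∀ u : V, ‖u‖ ^ 2 = ∑ i, inner ℝ (e i) u ^ 2 := fun u => by
      rw [← e.sum_sq_norm_inner_right u]
      exact Finset.sum_congr rfl fun i _ => by rw [Real.norm_eq_abs, sq_abs]
    obtain ⟨c, hc, hcx⟩ : ∃ c > 0, ∀ i, c ≤ x i := by
      rcases isEmpty_or_nonempty (Fin (Module.finrank ℝ V)) with h | h
      · exact ⟨1, one_pos, fun i => h.elim i⟩
      · obtain ⟨i, hi⟩ := Finite.exists_min x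
        exact ⟨x i, hd.pos i, hi⟩
    refine ⟨c, hc, fun u => ?_⟩
    rw [hval, hnorm, Finset.mul_sum]
    exact Finset.sum_le_sum fun i _ => mul_le_mul_of_nonneg_right (hcx i) (sq_nonneg _)
  filter_upwards [Metric.ball_mem_nhds g hc] with h hh u hu
  have h1 : |(h - g) u u| ≤ ‖h - g‖ * ‖u‖ ^ 2 := by
    have := (h - g).le_opNorm₂ u u
    rw [Real.norm_eq_abs] at this
    linarith [sq ‖u‖, mul_assoc ‖h - g‖ ‖u‖ ‖u‖]
  have h2 : ‖h - g‖ < c := by rwa [Metric.mem_ball, dist_eq_norm] at hh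
  have h3 : 0 < ‖u‖ ^ 2 := by positivity
  have h4 : ‖h - g‖ * ‖u‖ ^ 2 < c * ‖u‖ ^ 2 := mul_lt_mul_of_pos_right h2 h3
  have h5 := (abs_le.1 h1).1
  have h6 : (h - g) u u = h u u - g u u := by simp
  have h7 := hcg u
  linarith

end Inner

/-! ### The Ricci tensor of a homogeneous metric -/

section Ricci

variable {V : Type*} [NormedAddCommGroup V] [InnerProductSpace ℝ V] [FiniteDimensional ℝ V]

/-- The algebraic properties of the bracket `b = [·,·]_𝔪` and of `r = [[·,·]_𝔥,·]` on `𝔪`. -/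
structure IsBracket (b : V →ₗ[ℝ] V →ₗ[ℝ] V) (r : V →ₗ[ℝ] V →ₗ[ℝ] V →ₗ[ℝ] V) : Prop where
  skew : ∀ X Y, b X Y = -b Y X
  curv_skew : ∀ X Y Z, r X Y Z = -r Y X Z
  jacobi : ∀ X Y Z, (b (b X Y) Z + r X Y Z) + (b (b Y Z) X + r Y Z X) +
    (b (b Z X) Y + r Z X Y) = 0
  inner_skew : ∀ X Y Z, inner ℝ (b X Y) Z = -inner ℝ Y (b X Z)
  curv_nonpos : ∀ X Y, inner ℝ (r X Y Y) X ≤ 0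

variable {b : V →ₗ[ℝ] V →ₗ[ℝ] V} {r : V →ₗ[ℝ] V →ₗ[ℝ] V →ₗ[ℝ] V} {g : Form2 V}

theorem IsMetric.leviCivita_apply (hg : IsMetric g) (b : V →ₗ[ℝ] V →ₗ[ℝ] V) (X Y Z : V) :
    g (leviCivita b g X Y) Z = (1 / 2 : ℝ) * (g (b X Y) Z + g (b Z X) Y + g X (b Z Y)) := by
  change g (ContinuousLinearMap.inverse g (koszul b g X Y)) Z = _
  rw [hg.apply_inverse, koszul_apply]

/-- Torsion-freeness. With the metric property `leviCivita_skew` it drives both the trace formula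
for `Ric` and the vanishing of `tr_g dRic_g`. -/
theorem IsMetric.leviCivita_sub (hg : IsMetric g) (hb : ∀ X Y, b X Y = -b Y X) (X Y : V) :
    leviCivita b g X Y - leviCivita b g Y X = b X Y := by
  refine hg.ext fun Z => ?_
  rw [map_sub, sub_apply, hg.leviCivita_apply, hg.leviCivita_apply, hb Y X,
    hg.symm X, hg.symm Y]
  simp only [map_neg, neg_apply]
  ring

theorem IsMetric.leviCivita_skew (hg : IsMetric g) (hb : ∀ X Y, b X Y = -b Y X) (X Y Z : V) :
    g (leviCivita b g X Y) Z + g Y (leviCivita b g X Z) = 0 := by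
  rw [hg.symm Y, hg.leviCivita_apply, hg.leviCivita_apply, hb Z X, hb Y X, hb Z Y, hg.symm X,
    hg.symm X]
  simp only [map_neg, neg_apply]
  ring

/-- Unimodularity, from skewness for the Euclidean inner product; it removes the terms of `Ric` that
are linear in the mean curvature vector. -/
theorem IsBracket.trace_bracket (hb : IsBracket b r) (X : V) : LinearMap.trace ℝ V (b X) = 0 :=
  isMetric_euclideanForm.trace_eq_zero_of_skew fun u v => by
    rw [euclideanForm_apply, euclideanForm_apply, hb.inner_skew, neg_add_cancel]

theorem IsBracket.trace_bracket_flip (hb : IsBracket b r) (X : V) :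
    LinearMap.trace ℝ V (b.flip X) = 0 := by
  have h : b.flip X = -b X := by
    ext Y
    rw [LinearMap.flip_apply, hb.skew, LinearMap.neg_apply]
  rw [h, map_neg, hb.trace_bracket, neg_zero]

theorem ricciForm_apply (b : V →ₗ[ℝ] V →ₗ[ℝ] V) (r : V →ₗ[ℝ] V →ₗ[ℝ] V →ₗ[ℝ] V) (g : Form2 V)
    (Y Z : V) : ricciForm b r g Y Z = LinearMap.trace ℝ V (curvature b r g Y Z) := rfl

/-- `Ric(Y, Z) = - tr (Λ(·)Y ∘ Λ(·)Z) - tr (X ↦ [[X, Y]_𝔥, Z])`. -/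
theorem IsMetric.ricciForm_eq (hg : IsMetric g) (hb : IsBracket b r) (Y Z : V) :
    ricciForm b r g Y Z =
      -LinearMap.trace ℝ V ((leviCivita b g).flip Y ∘ₗ (leviCivita b g).flip Z) -
        LinearMap.trace ℝ V ((r.flip Y).flip Z) := by
  set L := leviCivita b g with hL
  have hflip : ∀ W, L.flip W = L W + b.flip W := fun W => by
    ext X
    have := hg.leviCivita_sub hb.skew X W
    rw [LinearMap.add_apply, LinearMap.flip_apply, LinearMap.flip_apply, ← this]
    abel
  -- Torsion-freeness rewrites `Λ([X, Y]_𝔪)Z` through `Λ` alone. Under the trace the first term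
  -- vanishes and the two products of `L Y` with `L.flip Z` cancel by cyclicity.
  have hcurv : curvature b r g Y Z = L.flip (L Y Z) - L Y ∘ₗ L.flip Z -
      L.flip Z ∘ₗ (L.flip Y - L Y) - (r.flip Y).flip Z := by
    have h : L.flip Y - L Y = b.flip Y := by rw [hflip]; abel
    rw [h]
    ext X
    rfl
  have ht : LinearMap.trace ℝ V (L.flip (L Y Z)) = 0 := by
    rw [hflip, map_add, hb.trace_bracket_flip, add_zero]
    exact hg.trace_eq_zero_of_skew fun u v => hg.leviCivita_skew hb.skew _ u v
  have hc : LinearMap.trace ℝ V (L.flip Z ∘ₗ L Y) = LinearMap.trace ℝ V (L Y ∘ₗ L.flip Z) :=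
    LinearMap.trace_mul_comm ℝ _ _
  have hc2 : LinearMap.trace ℝ V (L.flip Z ∘ₗ L.flip Y) =
      LinearMap.trace ℝ V (L.flip Y ∘ₗ L.flip Z) := LinearMap.trace_mul_comm ℝ _ _
  rw [ricciForm_apply, hcurv, LinearMap.comp_sub]
  simp only [map_sub, ht, hc, hc2]
  ring

/-- Take the trace over `X` of the Jacobi identity: the double brackets cancel by cyclicity, `b (b Y
Z)` is traceless, and `r Y Z` is traceless because it is `g`-skew. This is what makes `Ric`
symmetric. -/
theorem IsBracket.trace_curv_comm (hb : IsBracket b r) (hg : IsMetric g)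
    (hr : ∀ X Y Z W, g (r X Y Z) W + g Z (r X Y W) = 0) (Y Z : V) :
    LinearMap.trace ℝ V ((r.flip Y).flip Z) = LinearMap.trace ℝ V ((r.flip Z).flip Y) := by
  have h : (b.flip Z ∘ₗ b.flip Y + (r.flip Y).flip Z) + (b (b Y Z) + r Y Z) +
      (-(b.flip Y ∘ₗ b.flip Z) - (r.flip Z).flip Y) = 0 := by
    ext X
    have hj := hb.jacobi X Y Z
    have h1 : b (b Z X) Y = -b (b X Z) Y := by rw [hb.skew Z X, map_neg, LinearMap.neg_apply]
    rw [h1, hb.curv_skew Z X] at hj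
    simp only [LinearMap.add_apply, LinearMap.comp_apply, LinearMap.flip_apply,
      LinearMap.sub_apply, LinearMap.neg_apply, LinearMap.zero_apply]
    rw [← hj]
    abel
  have ht := congrArg (LinearMap.trace ℝ V) h
  have hc : LinearMap.trace ℝ V (b.flip Z ∘ₗ b.flip Y) =
      LinearMap.trace ℝ V (b.flip Y ∘ₗ b.flip Z) := LinearMap.trace_mul_comm ℝ _ _
  simp only [map_add, map_sub, map_neg, map_zero, hc, hb.trace_bracket,
    hg.trace_eq_zero_of_skew fun u v => hr Y Z u v] at ht
  linarith

theorem IsMetric.ricciForm_symm (hg : IsMetric g) (hb : IsBracket b r)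
    (hr : ∀ X Y Z W, g (r X Y Z) W + g Z (r X Y W) = 0) (Y Z : V) :
    ricciForm b r g Y Z = ricciForm b r g Z Y := by
  rw [hg.ricciForm_eq hb, hg.ricciForm_eq hb, hb.trace_curv_comm hg hr Y Z]
  congr 2
  exact LinearMap.trace_mul_comm ℝ _ _

/-- The Ricci tensor is invariant under linear automorphisms preserving `b`, `r` and `g`. -/
theorem ricciForm_equivariant (hg : IsMetric g) (ρ : V ≃ₗ[ℝ] V)
    (hρb : ∀ X Y, ρ (b X Y) = b (ρ X) (ρ Y))
    (hρr : ∀ X Y Z, ρ (r X Y Z) = r (ρ X) (ρ Y) (ρ Z))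
    (hρg : ∀ X Y, g (ρ X) (ρ Y) = g X Y) (Y Z : V) :
    ricciForm b r g (ρ Y) (ρ Z) = ricciForm b r g Y Z := by
  have hL : ∀ X Y, ρ (leviCivita b g X Y) = leviCivita b g (ρ X) (ρ Y) := fun X Y => by
    refine hg.ext fun W => ?_
    obtain ⟨W, rfl⟩ := ρ.surjective W
    rw [hρg, hg.leviCivita_apply, hg.leviCivita_apply, ← hρb, ← hρb, ← hρb, hρg, hρg, hρg]
  have h : curvature b r g (ρ Y) (ρ Z) = ρ.conj (curvature b r g Y Z) := by
    ext X
    rw [LinearEquiv.conj_apply_apply]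
    obtain ⟨X, rfl⟩ := ρ.surjective X
    rw [ρ.symm_apply_apply]
    change leviCivita b g (ρ X) (leviCivita b g (ρ Y) (ρ Z)) -
      leviCivita b g (ρ Y) (leviCivita b g (ρ X) (ρ Z)) - leviCivita b g (b (ρ X) (ρ Y)) (ρ Z) -
      r (ρ X) (ρ Y) (ρ Z) = ρ (leviCivita b g X (leviCivita b g Y Z) -
        leviCivita b g Y (leviCivita b g X Z) - leviCivita b g (b X Y) Z - r X Y Z)
    simp only [map_sub, hL, hρb, hρr]
  rw [ricciForm_apply, h, LinearMap.trace_conj', ricciForm_apply]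

theorem leviCivita_smul (hg : IsMetric g) {c : ℝ} (hc : 0 < c) :
    leviCivita b (c • g) = leviCivita b g := by
  ext X Y
  refine hg.ext fun Z => ?_
  have h := (hg.smul hc).leviCivita_apply b X Y Z
  simp only [smul_apply, smul_eq_mul] at h
  rw [hg.leviCivita_apply]
  exact mul_left_cancel₀ hc.ne' (by rw [h]; ring)

theorem ricciForm_smul (hg : IsMetric g) {c : ℝ} (hc : 0 < c) :
    ricciForm b r (c • g) = ricciForm b r g := by
  ext Y Z
  rw [ricciForm_apply, ricciForm_apply]
  congr 1
  ext X
  simp only [curvature, leviCivita_smul hg hc]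

/-! ### Schur's inequality and the sign of the Euclidean trace of `Ric`. -/

section Diag

variable {n : ℕ} {e : OrthonormalBasis (Fin n) ℝ V} {x : Fin n → ℝ}

/-- Total antisymmetry of the structure constants makes the three Koszul terms multiples of a single
one. -/
theorem IsDiag.inner_leviCivita (hd : IsDiag g e x) (hg : IsMetric g) (hb : IsBracket b r)
    (i j k : Fin n) :
    inner ℝ (e j) (leviCivita b g (e i) (e k)) =
      inner ℝ (e j) (b (e i) (e k)) * ((x j + x k - x i) / (2 * x j)) := by
  have hj := (hd.pos j).ne'
  have h1 : inner ℝ (e k) (b (e j) (e i)) = inner ℝ (e j) (b (e i) (e k)) := by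
    rw [hb.skew (e j), inner_neg_right, real_inner_comm, hb.inner_skew, neg_neg]
  have h2 : inner ℝ (e i) (b (e j) (e k)) = -inner ℝ (e j) (b (e i) (e k)) := by
    rw [hb.skew (e j), inner_neg_right, real_inner_comm, hb.inner_skew, hb.skew (e k),
      inner_neg_right, neg_neg]
  rw [hd.inner_eq, hg.leviCivita_apply, hd.right, hd.right, hd.left, h1, h2]
  field_simp
  ring

/-- The expression is Schur's sum `∑ x (x - y)(x - z) ≥ 0` plus `3xyz`. -/
theorem schur_pos {x y z : ℝ} (hx : 0 < x) (hy : 0 < y) (hz : 0 < z) :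
    0 < x * (x ^ 2 - (y - z) ^ 2) + y * (y ^ 2 - (z - x) ^ 2) + z * (z ^ 2 - (x - y) ^ 2) := by
  have h : 0 ≤ x * (x - y) * (x - z) + y * (y - x) * (y - z) + z * (z - x) * (z - y) := by
    rcases le_total x y with hxy | hxy <;> rcases le_total y z with hyz | hyz <;>
      rcases le_total x z with hxz | hxz <;>
      nlinarith [mul_nonneg (sub_nonneg.2 hxy) (sub_nonneg.2 hyz),
        mul_nonneg (sub_nonneg.2 hxy) (sub_nonneg.2 hxz),
        mul_nonneg (sub_nonneg.2 hxz) (sub_nonneg.2 hyz), sq_nonneg (x - y), sq_nonneg (y - z),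
        sq_nonneg (x - z), mul_nonneg hx.le (sq_nonneg (x - y)), mul_nonneg hy.le (sq_nonneg (x - y)),
        mul_nonneg hy.le (sq_nonneg (y - z)), mul_nonneg hz.le (sq_nonneg (y - z)),
        mul_nonneg hx.le (sq_nonneg (x - z)), mul_nonneg hz.le (sq_nonneg (x - z)),
        mul_nonneg hx.le (mul_nonneg (sub_nonneg.2 hxy) (sub_nonneg.2 hxz)),
        mul_nonneg hy.le (mul_nonneg (sub_nonneg.2 hxy) (sub_nonneg.2 hyz)),
        mul_nonneg hz.le (mul_nonneg (sub_nonneg.2 hxz) (sub_nonneg.2 hyz))]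
  have := mul_pos (mul_pos hx hy) hz
  nlinarith

/-- If the trace of the Ricci tensor of `g` with respect to `Q` is not positive, then
`[𝔪, 𝔪] = 0`. -/
theorem IsDiag.bracket_eq_zero (hd : IsDiag g e x) (hg : IsMetric g) (hb : IsBracket b r)
    (h : ∑ k, ricciForm b r g (e k) (e k) ≤ 0) :
    (∀ i j, b (e i) (e j) = 0) ∧ ∀ i k, inner ℝ (r (e i) (e k) (e k)) (e i) = 0 := by
  let B : Fin n → Fin n → Fin n → ℝ := fun i j k => inner ℝ (e k) (b (e i) (e j))
  have hB1 : ∀ i j k, B i j k = -B j i k := fun i j k => by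
    simp only [B]; rw [hb.skew, inner_neg_right]
  have hB2 : ∀ i j k, B i j k = -B i k j := fun i j k => by
    simp only [B]; rw [real_inner_comm, hb.inner_skew]
  have hcyc : ∀ i j k, B j k i = B i j k := fun i j k => by
    rw [hB2 j k i, hB1 j i k, neg_neg]
  let F : Fin n → Fin n → Fin n → ℝ := fun i j k =>
    B i j k ^ 2 * ((x k ^ 2 - (x i - x j) ^ 2) / (4 * x i * x j))
  have hricci : ∀ k, ricciForm b r g (e k) (e k) =
      ∑ i, ∑ j, F i j k + ∑ i, -inner ℝ (r (e i) (e k) (e k)) (e i) := fun k => by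
    rw [hg.ricciForm_eq hb, trace_comp_eq_sum e, LinearMap.trace_eq_sum_inner _ e,
      sub_eq_add_neg, ← Finset.sum_neg_distrib, ← Finset.sum_neg_distrib]
    congr 1
    · refine Finset.sum_congr rfl fun i _ => ?_
      rw [← Finset.sum_neg_distrib]
      refine Finset.sum_congr rfl fun j _ => ?_
      rw [LinearMap.flip_apply, LinearMap.flip_apply, hd.inner_leviCivita hg hb,
        hd.inner_leviCivita hg hb]
      change -(B j k i * _ * (B i k j * _)) = _
      have h2 : B i k j = -B i j k := hB2 i k j
      rw [hcyc, h2]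
      simp only [F]
      have hi := (hd.pos i).ne'
      have hj := (hd.pos j).ne'
      field_simp
      ring
    · refine Finset.sum_congr rfl fun i _ => ?_
      rw [real_inner_comm]
      rfl
  -- A single `F i j k` can be negative. Since `B²` is invariant under cyclic permutations, the sum
  -- is regrouped over cycles, and the weight of a cycle is positive by `schur_pos`.
  let S : Fin n → Fin n → Fin n → ℝ := fun i j k => F i j k + F j k i + F k i j
  have hS : ∀ i j k, S i j k = B i j k ^ 2 * ((x k * (x k ^ 2 - (x i - x j) ^ 2) +
      x i * (x i ^ 2 - (x j - x k) ^ 2) + x j * (x j ^ 2 - (x k - x i) ^ 2)) /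
      (4 * x i * x j * x k)) := fun i j k => by
    simp only [S, F]
    rw [hcyc i j k, ← hcyc k i j]
    have hi := (hd.pos i).ne'
    have hj := (hd.pos j).ne'
    have hk := (hd.pos k).ne'
    field_simp
  have hw : ∀ i j k, 0 < (x k * (x k ^ 2 - (x i - x j) ^ 2) +
      x i * (x i ^ 2 - (x j - x k) ^ 2) + x j * (x j ^ 2 - (x k - x i) ^ 2)) /
      (4 * x i * x j * x k) := fun i j k => by
    have hi := hd.pos i
    have hj := hd.pos j
    have hk := hd.pos k
    exact div_pos (schur_pos hk hi hj) (by positivity)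
  have hSnn : ∀ i j k, 0 ≤ S i j k := fun i j k => by
    rw [hS]; exact mul_nonneg (sq_nonneg _) (hw i j k).le
  have hsum : ∑ k, ∑ i, ∑ j, F i j k = (1 / 3 : ℝ) * ∑ i, ∑ j, ∑ k, S i j k := by
    have hrot : ∀ F : Fin n → Fin n → Fin n → ℝ,
        ∑ k, ∑ i, ∑ j, F i j k = ∑ i, ∑ j, ∑ k, F i j k := fun F => by
      rw [Finset.sum_comm]
      exact Finset.sum_congr rfl fun i _ => Finset.sum_comm
    have e1 := hrot F
    have e2 : ∑ i, ∑ j, ∑ k, F k i j = ∑ i, ∑ j, ∑ k, F i j k :=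
      (hrot fun i j k => F k i j).symm
    simp only [S, Finset.sum_add_distrib]
    rw [e1, e2]
    ring
  have hr : ∀ i k, 0 ≤ -inner ℝ (r (e i) (e k) (e k)) (e i) := fun i k => by
    have := hb.curv_nonpos (e i) (e k)
    linarith
  simp only [hricci, Finset.sum_add_distrib] at h
  rw [hsum] at h
  have hA : 0 ≤ ∑ i, ∑ j, ∑ k, S i j k := Finset.sum_nonneg fun i _ =>
    Finset.sum_nonneg fun j _ => Finset.sum_nonneg fun k _ => hSnn i j k
  have hC : 0 ≤ ∑ k, ∑ i, -inner ℝ (r (e i) (e k) (e k)) (e i) := Finset.sum_nonneg fun k _ =>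
    Finset.sum_nonneg fun i _ => hr i k
  -- The trace is a sum of two non-negative parts, so being non-positive it forces both to vanish,
  -- and then every summand.
  have hA0 : ∑ i, ∑ j, ∑ k, S i j k = 0 := by linarith
  have hC0 : ∑ k, ∑ i, -inner ℝ (r (e i) (e k) (e k)) (e i) = 0 := by linarith
  constructor
  · intro i j
    have hz : ∀ k, B i j k = 0 := fun k => by
      rw [Finset.sum_eq_zero_iff_of_nonneg fun i _ =>
        Finset.sum_nonneg fun j _ => Finset.sum_nonneg fun k _ => hSnn i j k] at hA0
      have h1 := hA0 i (Finset.mem_univ i)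
      rw [Finset.sum_eq_zero_iff_of_nonneg fun j _ => Finset.sum_nonneg fun k _ => hSnn i j k]
        at h1
      have h2 := h1 j (Finset.mem_univ j)
      rw [Finset.sum_eq_zero_iff_of_nonneg fun k _ => hSnn i j k] at h2
      have h3 := h2 k (Finset.mem_univ k)
      rw [hS, mul_eq_zero] at h3
      rcases h3 with h3 | h3
      · exact pow_eq_zero_iff two_ne_zero |>.1 h3
      · exact absurd h3 (hw i j k).ne'
    rw [← e.sum_repr' (b (e i) (e j))]
    exact Finset.sum_eq_zero fun k _ => by
      rw [show inner ℝ (e k) (b (e i) (e j)) = 0 from hz k, zero_smul]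
  · intro i k
    rw [Finset.sum_eq_zero_iff_of_nonneg fun k _ => Finset.sum_nonneg fun i _ => hr i k] at hC0
    have h1 := hC0 k (Finset.mem_univ k)
    rw [Finset.sum_eq_zero_iff_of_nonneg fun i _ => hr i k] at h1
    have h2 := h1 i (Finset.mem_univ i)
    linarith

end Diag

end Ricci

/-! ### Smoothness and the first variation of the scalar curvature -/

section Variation

variable {V : Type*} [NormedAddCommGroup V] [InnerProductSpace ℝ V] [FiniteDimensional ℝ V]
  {b : V →ₗ[ℝ] V →ₗ[ℝ] V} {r : V →ₗ[ℝ] V →ₗ[ℝ] V →ₗ[ℝ] V} {g : Form2 V}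

theorem contDiffAt_inverse (hg : IsMetric g) :
    ContDiffAt ℝ ∞ (ContinuousLinearMap.inverse : Form2 V → _) g :=
  hg.isInvertible.contDiffAt_map_inverse

theorem contDiffAt_leviCivita (hg : IsMetric g) (b : V →ₗ[ℝ] V →ₗ[ℝ] V) (X Y : V) :
    ContDiffAt ℝ ∞ (fun h : Form2 V => leviCivita b h X Y) g := by
  let K : Form2 V →ₗ[ℝ] V →L[ℝ] ℝ :=
    { toFun := fun h => koszul b h X Y
      map_add' := fun h h' => by
        ext Z
        simp only [koszul_apply, add_apply]
        ring
      map_smul' := fun c h => by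
        ext Z
        simp only [koszul_apply, smul_apply, smul_eq_mul, RingHom.id_apply]
        ring }
  exact (contDiffAt_inverse hg).clm_apply (LinearMap.toContinuousLinearMap K).contDiff.contDiffAt

theorem contDiffAt_leviCivita_comp (hg : IsMetric g) (b : V →ₗ[ℝ] V →ₗ[ℝ] V) (X : V)
    {f : Form2 V → V} (hf : ContDiffAt ℝ ∞ f g) :
    ContDiffAt ℝ ∞ (fun h : Form2 V => leviCivita b h X (f h)) g := by
  let e := stdOrthonormalBasis ℝ V
  have h : (fun h : Form2 V => leviCivita b h X (f h)) =
      fun h => ∑ i, inner ℝ (e i) (f h) • leviCivita b h X (e i) := by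
    funext h
    conv_lhs => rw [← e.sum_repr' (f h)]
    simp
  rw [h]
  exact ContDiffAt.sum fun i _ => (contDiffAt_const.inner ℝ hf).smul (contDiffAt_leviCivita hg b _ _)

theorem contDiffAt_form {W : Type*} [NormedAddCommGroup W] [NormedSpace ℝ W] {F : W → Form2 V}
    {p : W} {n : ℕ∞ω} (h : ∀ u v, ContDiffAt ℝ n (fun w => F w u v) p) : ContDiffAt ℝ n F p := by
  let e := stdOrthonormalBasis ℝ V
  have hF : F = fun w => ∑ i, ∑ j, F w (e i) (e j) •
      (LinearMap.toContinuousBilinearMap (LinearMap.mk₂ ℝ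
        (fun u v => inner ℝ (e i) u * inner ℝ (e j) v)
        (by intros; rw [inner_add_right, add_mul])
        (by intros; rw [inner_smul_right, mul_assoc, smul_eq_mul])
        (by intros; rw [inner_add_right, mul_add])
        (by intros; rw [inner_smul_right, smul_eq_mul]; ring)) : Form2 V) := by
    funext w
    ext u v
    conv_lhs => rw [← e.sum_repr' u, ← e.sum_repr' v]
    simp only [map_sum, map_smul, sum_apply, smul_apply, smul_eq_mul, Finset.mul_sum,
      LinearMap.toContinuousBilinearMap_apply, LinearMap.mk₂_apply]
    rw [Finset.sum_comm]
    exact Finset.sum_congr rfl fun i _ => Finset.sum_congr rfl fun j _ => by ring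
  rw [hF]
  exact ContDiffAt.sum fun i _ => ContDiffAt.sum fun j _ => (h _ _).smul contDiffAt_const

theorem contDiffAt_ricciForm (hg : IsMetric g) : ContDiffAt ℝ ∞ (ricciForm b r) g := by
  refine contDiffAt_form fun Y Z => ?_
  let e := stdOrthonormalBasis ℝ V
  have h : (fun h : Form2 V => ricciForm b r h Y Z) = fun h => ∑ i, inner ℝ (e i)
      (leviCivita b h (e i) (leviCivita b h Y Z) - leviCivita b h Y (leviCivita b h (e i) Z)
        - leviCivita b h (b (e i) Y) Z - r (e i) Y Z) := by
    funext h
    rw [ricciForm_apply, LinearMap.trace_eq_sum_inner _ e]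
    rfl
  rw [h]
  refine ContDiffAt.sum fun i _ => contDiffAt_const.inner ℝ ?_
  exact (((contDiffAt_leviCivita_comp hg b _ (contDiffAt_leviCivita hg b _ _)).sub
    (contDiffAt_leviCivita_comp hg b _ (contDiffAt_leviCivita hg b _ _))).sub
    (contDiffAt_leviCivita hg b _ _)).sub contDiffAt_const

/-- Differentiate `h⁻¹ h = id`, which holds near `g` because invertible maps form an open set. -/
theorem exists_hasFDerivAt_inverse (hg : IsMetric g) :
    ∃ D : Form2 V →L[ℝ] ((V →L[ℝ] ℝ) →L[ℝ] V),
      HasFDerivAt (ContinuousLinearMap.inverse : Form2 V → _) D g ∧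
      ∀ X, D X = -(ContinuousLinearMap.inverse g ∘L X ∘L ContinuousLinearMap.inverse g) := by
  have hd := ((contDiffAt_inverse hg).differentiableAt (by simp)).hasFDerivAt
  refine ⟨_, hd, fun X => ?_⟩
  have hprod := hd.clm_comp (hasFDerivAt_id g)
  have hev : (fun h : Form2 V => ContinuousLinearMap.inverse h ∘L id h) =ᶠ[𝓝 g]
      fun _ => ContinuousLinearMap.id ℝ V := by
    obtain ⟨e, he⟩ := hg.isInvertible
    have := ContinuousLinearEquiv.nhds e
    rw [he] at this
    filter_upwards [this] with h hh
    obtain ⟨e', rfl⟩ := hh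
    ext u
    simp
  have h0 := (hprod.congr_of_eventuallyEq hev.symm).unique
    (hasFDerivAt_const (ContinuousLinearMap.id ℝ V) g)
  ext φ
  have h1 := congrArg (fun L : Form2 V →L[ℝ] V →L[ℝ] V =>
    L X (ContinuousLinearMap.inverse g φ)) h0
  simp [hg.apply_inverse] at h1
  simp only [neg_apply, ContinuousLinearMap.comp_apply]
  rw [eq_neg_iff_add_eq_zero, add_comm]
  exact h1

/-- The trace pairing `(L, A) ↦ tr (L ∘ A)`. -/
def tracePairing : ((V →L[ℝ] ℝ) →L[ℝ] V) →L[ℝ] Form2 V →L[ℝ] ℝ :=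
  LinearMap.toContinuousBilinearMap <| LinearMap.mk₂ ℝ
    (fun L A => LinearMap.trace ℝ V (L ∘L A : V →L[ℝ] V).toLinearMap)
    (by intros; simp [ContinuousLinearMap.add_comp])
    (by intros; simp [ContinuousLinearMap.smul_comp])
    (by intros; simp [ContinuousLinearMap.comp_add])
    (by intros; simp)

theorem traceWrt_eq_tracePairing (h A : Form2 V) :
    traceWrt h A = tracePairing (ContinuousLinearMap.inverse h) A := rfl

theorem innerWrt_eq_tracePairing (h A B : Form2 V) :
    innerWrt h A B =
      tracePairing (ContinuousLinearMap.inverse h) (A ∘L ContinuousLinearMap.inverse h ∘L B) :=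
  rfl

theorem contDiffAt_traceWrt {W : Type*} [NormedAddCommGroup W] [NormedSpace ℝ W]
    {γ A : W → Form2 V} {p : W} {n : ℕ∞} (hg : IsMetric (γ p)) (hγ : ContDiffAt ℝ n γ p)
    (hA : ContDiffAt ℝ n A p) : ContDiffAt ℝ n (fun w => traceWrt (γ w) (A w)) p := by
  simp only [traceWrt_eq_tracePairing]
  have h1 : ContDiffAt ℝ n (fun w => ContinuousLinearMap.inverse (γ w)) p :=
    ((contDiffAt_inverse hg).of_le (by exact_mod_cast le_top)).comp p hγ
  exact ((tracePairing (V := V)).contDiff.contDiffAt.comp p h1).clm_apply hA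

/-- The derivative of `tr_γ A`. -/
theorem exists_hasFDerivAt_traceWrt {W : Type*} [NormedAddCommGroup W] [NormedSpace ℝ W]
    {γ A : W → Form2 V} {γ' A' : W →L[ℝ] Form2 V} {p : W} (hg : IsMetric (γ p))
    (hγ : HasFDerivAt γ γ' p) (hA : HasFDerivAt A A' p) :
    ∃ L : W →L[ℝ] ℝ, HasFDerivAt (fun w => traceWrt (γ w) (A w)) L p ∧
      ∀ X, L X = traceWrt (γ p) (A' X) - innerWrt (γ p) (A p) (γ' X) := by
  simp only [traceWrt_eq_tracePairing]
  obtain ⟨D, hD, hDX⟩ := exists_hasFDerivAt_inverse hg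
  have h1 := HasFDerivAt.comp (g := (ContinuousLinearMap.inverse : Form2 V → _)) p hD hγ
  refine ⟨_, ((tracePairing (V := V)).hasFDerivAt.comp p h1).clm_apply hA, fun X => ?_⟩
  rw [innerWrt_comm, innerWrt_eq_tracePairing]
  simp only [add_apply, ContinuousLinearMap.comp_apply, ContinuousLinearMap.flip_apply, hDX,
    map_neg, neg_apply, Function.comp_apply]
  rw [← sub_eq_add_neg]
  rfl

/-- The derivative of `⟨v, B⟩_γ` where `v = 0`. -/
theorem exists_hasFDerivAt_innerWrt {W : Type*} [NormedAddCommGroup W] [NormedSpace ℝ W]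
    {γ v : W → Form2 V} {γ' v' : W →L[ℝ] Form2 V} {p : W} (hg : IsMetric (γ p))
    (hγ : HasFDerivAt γ γ' p) (hv : HasFDerivAt v v' p) (h0 : v p = 0) (B : Form2 V) :
    ∃ L : W →L[ℝ] ℝ, HasFDerivAt (fun w => innerWrt (γ w) (v w) B) L p ∧
      ∀ X, L X = innerWrt (γ p) (v' X) B := by
  simp only [innerWrt_eq_tracePairing]
  obtain ⟨D, hD, hDX⟩ := exists_hasFDerivAt_inverse hg
  have h1 := HasFDerivAt.comp (g := (ContinuousLinearMap.inverse : Form2 V → _)) p hD hγ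
  have h2 := hv.clm_comp (h1.clm_comp (hasFDerivAt_const B p))
  refine ⟨_, ((tracePairing (V := V)).hasFDerivAt.comp p h1).clm_apply h2, fun X => ?_⟩
  simp [h0]

theorem hasDerivAt_form_apply {F : ℝ → Form2 V} {F' : Form2 V} {t : ℝ} (h : HasDerivAt F F' t)
    (u v : V) : HasDerivAt (fun t => F t u v) (F' u v) t :=
  (ContinuousLinearMap.apply ℝ ℝ v).hasFDerivAt.comp_hasDerivAt t
    ((ContinuousLinearMap.apply ℝ (V →L[ℝ] ℝ) u).hasFDerivAt.comp_hasDerivAt t h)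

/-- Product rule for a diagonal entry of `Ric`: `L i j k` stands for `⟨e_k, Λ(e_i) e_j⟩`, and the
constant `c` for the isotropy term, which does not depend on the metric. -/
theorem hasDerivAt_sum_mul {n : ℕ} {L : Fin n → Fin n → Fin n → ℝ → ℝ}
    {D : Fin n → Fin n → Fin n → ℝ} (hD : ∀ i j k, HasDerivAt (L i j k) (D i j k) 0)
    (i : Fin n) (c : ℝ) :
    HasDerivAt (fun t : ℝ => -∑ j, ∑ k, L k i j t * L j i k t - c)
      (-∑ j, ∑ k, (D k i j * L j i k 0 + L k i j 0 * D j i k)) 0 :=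
  (HasDerivAt.fun_sum fun j _ => HasDerivAt.fun_sum fun k _ =>
    (hD k i j).mul (hD j i k)).neg.sub_const _

/-- The two halves of the product rule agree after exchanging `j` and `k`. Each is the contraction
of `D`, symmetric in its first two indices, with the skew array `L j i k / x i`, so exchanging `i`
and `k` reverses its sign. -/
theorem sum_divergence_eq_zero {n : ℕ} {L D : Fin n → Fin n → Fin n → ℝ} {x : Fin n → ℝ}
    (hD : ∀ i j k, D i j k = D j i k) (hL : ∀ i j k, L i j k / x j = -(L i k j / x k)) :
    ∑ i, (-∑ j, ∑ k, (D k i j * L j i k + L k i j * D j i k)) / x i = 0 := by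
  have hrev : ∀ F : Fin n → Fin n → Fin n → ℝ,
      ∑ i, ∑ j, ∑ k, F i j k = ∑ k, ∑ j, ∑ i, F i j k := fun F => by
    rw [Finset.sum_comm]
    conv_rhs => rw [Finset.sum_comm]
    exact Finset.sum_congr rfl fun j _ => Finset.sum_comm
  have hzero : ∑ i, ∑ j, ∑ k, D k i j * L j i k / x i = 0 := by
    have h1 : ∑ i, ∑ j, ∑ k, D k i j * L j i k / x i =
        -∑ i, ∑ j, ∑ k, D k i j * L j i k / x i := by
      calc ∑ i, ∑ j, ∑ k, D k i j * L j i k / x i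
          = ∑ i, ∑ j, ∑ k, -(D i k j * L j k i / x k) :=
            Finset.sum_congr rfl fun i _ => Finset.sum_congr rfl fun j _ =>
              Finset.sum_congr rfl fun k _ => by
                rw [mul_div_assoc, hL, hD k i j, mul_div_assoc, mul_neg]
        _ = -∑ i, ∑ j, ∑ k, D i k j * L j k i / x k := by
            simp only [Finset.sum_neg_distrib]
        _ = _ := by rw [hrev]
    linarith
  have hexp : ∀ i, (-∑ j, ∑ k, (D k i j * L j i k + L k i j * D j i k)) / x i =
      -(2 * ∑ j, ∑ k, D k i j * L j i k / x i) := fun i => by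
    have hsw : ∑ j, ∑ k, L k i j * D j i k = ∑ j, ∑ k, D k i j * L j i k := by
      rw [Finset.sum_comm]
      exact Finset.sum_congr rfl fun j _ => Finset.sum_congr rfl fun k _ => mul_comm _ _
    simp only [Finset.sum_add_distrib, hsw, ← Finset.sum_div]
    ring
  simp only [hexp, Finset.sum_neg_distrib, ← Finset.mul_sum, hzero, mul_zero, neg_zero]

/-- The divergence-form identity: the trace of the linearized Ricci tensor vanishes. -/
theorem traceWrt_fderiv_ricciForm (hg : IsMetric g) (hb : IsBracket b r) {X : Form2 V}
    (hX : ∀ u v, X u v = X v u) :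
    traceWrt g (fderiv ℝ (ricciForm b r) g X) = 0 := by
  obtain ⟨e, x, hd⟩ := hg.exists_isDiag
  have hline : HasDerivAt (fun t : ℝ => g + t • X) X 0 := by
    simpa using ((hasDerivAt_id (0 : ℝ)).smul_const X).const_add g
  have hline0 : g + (0 : ℝ) • X = g := by simp
  have hmetric : ∀ᶠ t in 𝓝 (0 : ℝ), IsMetric (g + t • X) := by
    have hc : Filter.Tendsto (fun t : ℝ => g + t • X) (𝓝 0) (𝓝 g) := by
      simpa using hline.continuousAt.tendsto
    filter_upwards [hc.eventually hg.eventually_pos] with t ht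
    exact ⟨fun u v => by simp [hg.symm u v, hX u v], ht⟩
  let L : Fin (Module.finrank ℝ V) → Fin (Module.finrank ℝ V) → Fin (Module.finrank ℝ V) →
    ℝ → ℝ := fun i j k t => inner ℝ (e k) (leviCivita b (g + t • X) (e i) (e j))
  let D : Fin (Module.finrank ℝ V) → Fin (Module.finrank ℝ V) → Fin (Module.finrank ℝ V) →
    ℝ := fun i j k => deriv (L i j k) 0
  have hD : ∀ i j k, HasDerivAt (L i j k) (D i j k) 0 := fun i j k => by
    have h1 : DifferentiableAt ℝ (fun h : Form2 V => leviCivita b h (e i) (e j))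
        (g + (0 : ℝ) • X) := by
      rw [hline0]; exact (contDiffAt_leviCivita hg b (e i) (e j)).differentiableAt (by simp)
    have h2 := (h1.comp (0 : ℝ) hline.differentiableAt)
    exact ((differentiableAt_const (e k)).inner ℝ h2).hasDerivAt
  -- The antisymmetric part of `Λ` is the bracket, which does not move with the metric.
  have hDsymm : ∀ i j k, D i j k = D j i k := fun i j k => by
    have h1 := (hD i j k).sub (hD j i k)
    have h2 : (L i j k - L j i k) =ᶠ[𝓝 0] fun _ => inner ℝ (e k) (b (e i) (e j)) := by
      filter_upwards [hmetric] with t ht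
      simp only [Pi.sub_apply, L]
      rw [← inner_sub_right, ht.leviCivita_sub hb.skew]
    have h3 := (h1.congr_of_eventuallyEq h2.symm).unique (hasDerivAt_const _ _)
    linarith
  have hLskew : ∀ i j k, L i j k 0 / x j = -(L i k j 0 / x k) := fun i j k => by
    have h := hg.leviCivita_skew hb.skew (e i) (e j) (e k)
    simp only [L, hline0]
    rw [hd.left, hd.right] at h
    have hj := (hd.pos j).ne'
    have hk := (hd.pos k).ne'
    field_simp
    linarith
  have hric : ∀ i, fderiv ℝ (ricciForm b r) g X (e i) (e i) =
      -∑ j, ∑ k, (D k i j * L j i k 0 + L k i j 0 * D j i k) := fun i => by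
    have h1 : HasDerivAt (fun t : ℝ => ricciForm b r (g + t • X) (e i) (e i))
        (fderiv ℝ (ricciForm b r) g X (e i) (e i)) 0 := by
      have hf : HasFDerivAt (ricciForm b r) (fderiv ℝ (ricciForm b r) g) (g + (0 : ℝ) • X) := by
        rw [hline0]
        exact ((contDiffAt_ricciForm hg).differentiableAt (by simp)).hasFDerivAt
      exact hasDerivAt_form_apply (hf.comp_hasDerivAt (0 : ℝ) hline) (e i) (e i)
    have h2 := hasDerivAt_sum_mul hD i (LinearMap.trace ℝ V ((r.flip (e i)).flip (e i)))
    refine h1.unique (h2.congr_of_eventuallyEq ?_)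
    filter_upwards [hmetric] with t ht
    rw [ht.ricciForm_eq hb, trace_comp_eq_sum e]
    rfl
  rw [hd.traceWrt_eq hg]
  simp only [hric]
  exact sum_divergence_eq_zero (L := fun i j k => L i j k 0) hDsymm hLskew

end Variation

/-! ### The Ricci curvature on the space of homogeneous metrics -/

section Homogeneous

variable {E : Type*} [NormedAddCommGroup E] [NormedSpace ℝ E] [FiniteDimensional ℝ E]
  {G : Type*} [TopologicalSpace G] [ChartedSpace E G] [Group G] [LieGroup 𝓘(ℝ, E) ∞ G]
  {Q : BiinvariantMetric E G} {H : Subgroup G}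

theorem isMetric_of_mem {g : invariantTensors Q H} (hg : g ∈ metrics Q H) : IsMetric g.1 :=
  ⟨g.2.1, hg⟩

theorem inner_bracketHM_self (X Y : IsotropySpace Q H) :
    inner ℝ (bracketHM Q H X Y Y) X = -Q.form (bracketH Q H X Y) (bracketH Q H X Y) := by
  rw [inner_bracketHM, bracketH_skew Y X, map_neg]

variable (Q H) in
theorem isBracket : IsBracket (bracketM Q H) (bracketHM Q H) where
  skew := bracketM_skew
  curv_skew := bracketHM_skew
  jacobi := bracket_jacobi
  inner_skew := inner_bracketM
  curv_nonpos X Y := by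
    rw [inner_bracketHM_self, neg_nonpos]
    by_cases h : bracketH Q H X Y = 0
    · simp [h]
    · exact (Q.pos _ h).le

theorem ricci_mem {g : invariantTensors Q H} (hg : g ∈ metrics Q H) :
    ricci g ∈ invariantTensors Q H := by
  refine ⟨(isMetric_of_mem hg).ricciForm_symm (isBracket Q H) (invariant_bracketHM g.2),
    fun a u v => ?_⟩
  exact ricciForm_equivariant (isMetric_of_mem hg) (isotropyEquiv Q a)
    (isotropyRep_bracketM a) (isotropyRep_bracketHM a) (g.2.2 a) u v

theorem contDiffAt_coe (g : invariantTensors Q H) {n : ℕ∞ω} :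
    ContDiffAt ℝ n (fun h : invariantTensors Q H => h.1) g :=
  (invariantTensors Q H).subtypeL.contDiff.contDiffAt

theorem contDiffAt_ricci {g : invariantTensors Q H} (hg : g ∈ metrics Q H) :
    ContDiffAt ℝ ∞ (ricci (Q := Q) (H := H)) g :=
  (contDiffAt_ricciForm (isMetric_of_mem hg)).comp g (contDiffAt_coe g)

theorem eventually_mem_metrics {g : invariantTensors Q H} (hg : g ∈ metrics Q H) :
    ∀ᶠ h in 𝓝 g, h ∈ metrics Q H :=
  (continuous_subtype_val.tendsto g).eventually (isMetric_of_mem hg).eventually_pos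

theorem hasFDerivAt_ricci {g : invariantTensors Q H} (hg : g ∈ metrics Q H) :
    HasFDerivAt ricci (dRicci g) g :=
  ((contDiffAt_ricci hg).differentiableAt (by simp)).hasFDerivAt

theorem hasFDerivAt_coe (g : invariantTensors Q H) :
    HasFDerivAt (fun h : invariantTensors Q H => h.1) (invariantTensors Q H).subtypeL g :=
  (invariantTensors Q H).subtypeL.hasFDerivAt

theorem traceWrt_dRicci {g : invariantTensors Q H} (hg : g ∈ metrics Q H)
    (X : invariantTensors Q H) : traceWrt g.1 (dRicci g X) = 0 := by
  have h := ((contDiffAt_ricciForm (b := bracketM Q H) (r := bracketHM Q H)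
    (isMetric_of_mem hg)).differentiableAt (by simp)).hasFDerivAt.comp g (hasFDerivAt_coe g)
  rw [(hasFDerivAt_ricci hg).unique h]
  exact traceWrt_fderiv_ricciForm (isMetric_of_mem hg) (isBracket Q H) X.2.1

theorem hasDerivAt_line (g X : invariantTensors Q H) :
    HasDerivAt (fun t : ℝ => g + t • X) X 0 := by
  simpa using ((hasDerivAt_id (0 : ℝ)).smul_const X).const_add g

theorem tendsto_line (g X : invariantTensors Q H) :
    Filter.Tendsto (fun t : ℝ => g + t • X) (𝓝 0) (𝓝 g) := by
  simpa using (hasDerivAt_line g X).continuousAt.tendsto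

theorem hasDerivAt_ricci_line {g : invariantTensors Q H} (hg : g ∈ metrics Q H)
    (X : invariantTensors Q H) :
    HasDerivAt (fun t : ℝ => ricci (g + t • X)) (dRicci g X) 0 := by
  have h : HasFDerivAt ricci (dRicci g) (g + (0 : ℝ) • X) := by
    rw [zero_smul, add_zero]; exact hasFDerivAt_ricci hg
  exact HasFDerivAt.comp_hasDerivAt (l := ricci) (f := fun t : ℝ => g + t • X) (0 : ℝ) h
    (hasDerivAt_line g X)

/-- `ricci` is valued in all bilinear forms, so symmetry and invariance are differentiated along the
line `g + tX`, which consists of metrics for small `t`. -/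
theorem dRicci_mem {g : invariantTensors Q H} (hg : g ∈ metrics Q H)
    (X : invariantTensors Q H) : dRicci g X ∈ invariantTensors Q H := by
  have h := fun u v => hasDerivAt_form_apply (hasDerivAt_ricci_line hg X) u v
  have hev := (tendsto_line g X).eventually (eventually_mem_metrics hg)
  constructor
  · intro u v
    refine (h u v).unique ((h v u).congr_of_eventuallyEq ?_)
    filter_upwards [hev] with t ht
    exact (ricci_mem ht).1 u v
  · intro a u v
    refine (h _ _).unique ((h u v).congr_of_eventuallyEq ?_)
    filter_upwards [hev] with t ht
    exact (ricci_mem ht).2 a u v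

theorem ricci_smul {g : invariantTensors Q H} (hg : g ∈ metrics Q H) {c : ℝ} (hc : 0 < c) :
    ricci (c • g) = ricci g :=
  ricciForm_smul (isMetric_of_mem hg) hc

theorem smul_mem_metrics {g : invariantTensors Q H} (hg : g ∈ metrics Q H) {c : ℝ} (hc : 0 < c) :
    c • g ∈ metrics Q H :=
  ((isMetric_of_mem hg).smul hc).pos

/-- `Ric` is constant along the ray through `g`. -/
theorem dRicci_self {g : invariantTensors Q H} (hg : g ∈ metrics Q H) : dRicci g g = 0 := by
  refine (hasDerivAt_ricci_line hg g).unique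
    ((hasDerivAt_const (0 : ℝ) (ricci g)).congr_of_eventuallyEq ?_)
  filter_upwards [lt_mem_nhds (show (-1 : ℝ) < 0 by norm_num)] with t ht
  have : g + t • g = (1 + t) • g := by rw [add_smul, one_smul]
  rw [this, ricci_smul hg (by linarith)]

theorem dRicci_smul {g : invariantTensors Q H} (hg : g ∈ metrics Q H) {c : ℝ} (hc : 0 < c)
    (X : invariantTensors Q H) : c • dRicci (c • g) X = dRicci g X := by
  have h1 : HasFDerivAt (fun h : invariantTensors Q H => c • h)
      (c • ContinuousLinearMap.id ℝ (invariantTensors Q H)) g :=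
    (hasFDerivAt_id g).const_smul c
  have h2 := HasFDerivAt.comp g (hasFDerivAt_ricci (smul_mem_metrics hg hc)) h1
  have h3 := (hasFDerivAt_ricci hg).unique (h2.congr_of_eventuallyEq (by
    filter_upwards [eventually_mem_metrics hg] with h hh
    exact (ricci_smul hh hc).symm))
  rw [h3]
  simp

theorem contDiffAt_scalarCurvature {g : invariantTensors Q H} (hg : g ∈ metrics Q H) :
    ContDiffAt ℝ ∞ (scalarCurvature (Q := Q) (H := H)) g :=
  contDiffAt_traceWrt (isMetric_of_mem hg) (contDiffAt_coe g) (contDiffAt_ricci hg)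

/-- The first variation of the scalar curvature is `-⟨Ric(g), ·⟩_g`. -/
theorem exists_hasFDerivAt_scalarCurvature {g : invariantTensors Q H} (hg : g ∈ metrics Q H) :
    ∃ L : invariantTensors Q H →L[ℝ] ℝ, HasFDerivAt scalarCurvature L g ∧
      ∀ X, L X = -innerWrt g.1 (ricci g) X.1 := by
  obtain ⟨L, hL, hLX⟩ := exists_hasFDerivAt_traceWrt (isMetric_of_mem hg) (hasFDerivAt_coe g)
    (hasFDerivAt_ricci hg)
  refine ⟨L, hL, fun X => ?_⟩
  rw [hLX, traceWrt_dRicci hg, zero_sub]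
  rfl

theorem contDiffAt_traceWrt_const {g : invariantTensors Q H} (hg : g ∈ metrics Q H)
    (T : invariantTensors Q H) :
    ContDiffAt ℝ ∞ (fun h : invariantTensors Q H => traceWrt h.1 T.1) g :=
  contDiffAt_traceWrt (isMetric_of_mem hg) (contDiffAt_coe g) contDiffAt_const

theorem exists_hasFDerivAt_traceWrt_const {g : invariantTensors Q H} (hg : g ∈ metrics Q H)
    (T : invariantTensors Q H) :
    ∃ L : invariantTensors Q H →L[ℝ] ℝ,
      HasFDerivAt (fun h : invariantTensors Q H => traceWrt h.1 T.1) L g ∧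
      ∀ X, L X = -innerWrt g.1 T.1 X.1 := by
  obtain ⟨L, hL, hLX⟩ := exists_hasFDerivAt_traceWrt (isMetric_of_mem hg) (hasFDerivAt_coe g)
    (hasFDerivAt_const T.1 g)
  refine ⟨L, hL, fun X => ?_⟩
  rw [hLX]
  simp [traceWrt, raise]

/-! ### The hypersurface `𝓜_T` -/

variable {T g : invariantTensors Q H}

theorem innerWrt_self_right_of_mem (hg : g ∈ metricsT T) : innerWrt g.1 T.1 g.1 = 1 := by
  rw [(isMetric_of_mem hg.1).innerWrt_self_right, hg.2]

theorem innerWrt_deriv_eq_zero (hg : g ∈ metricsT T) {γ : ℝ → invariantTensors Q H}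
    (hγ : IsCurveIn (metricsT T) g γ) : innerWrt g.1 T.1 (deriv γ 0).1 = 0 := by
  obtain ⟨hc, h0, hN⟩ := hγ
  obtain ⟨L, hL, hLX⟩ := exists_hasFDerivAt_traceWrt_const hg.1 T
  have hd : HasDerivAt γ (deriv γ 0) 0 := (hc.differentiableAt (by norm_num)).hasDerivAt
  rw [← h0] at hL
  have h1 := hL.comp_hasDerivAt (0 : ℝ) hd
  have h2 := h1.unique ((hasDerivAt_const (0 : ℝ) (1 : ℝ)).congr_of_eventuallyEq (by
    filter_upwards [hN] with t ht
    exact ht.2))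
  rw [hLX] at h2
  linarith

/-- Since `tr_{sh} T = s⁻¹ tr_h T`, the rescaling `h ↦ (tr_h T) h` sends metrics with `tr_h T > 0`
into `𝓜_T`. Applied to the line `g + tX`, the scaling factor has derivative `-⟨T, X⟩_g = 0` at `t =
0`, so the velocity is still `X`. -/
theorem exists_isCurveIn (hg : g ∈ metricsT T) {X : invariantTensors Q H}
    (hX : innerWrt g.1 T.1 X.1 = 0) : ∃ γ, IsCurveIn (metricsT T) g γ ∧ deriv γ 0 = X := by
  have hline0 : g + (0 : ℝ) • X = g := by simp
  have hline : ContDiff ℝ ∞ (fun t : ℝ => g + t • X) := by fun_prop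
  have hφ : ContDiffAt ℝ ∞ (fun t : ℝ => traceWrt (g + t • X).1 T.1) 0 := by
    refine ContDiffAt.comp (g := fun h : invariantTensors Q H => traceWrt h.1 T.1) (0 : ℝ) ?_
      hline.contDiffAt
    rw [hline0]
    exact contDiffAt_traceWrt_const hg.1 T
  have hφ0 : traceWrt (g + (0 : ℝ) • X).1 T.1 = 1 := by rw [hline0]; exact hg.2
  refine ⟨fun t => traceWrt (g + t • X).1 T.1 • (g + t • X),
    ⟨(hφ.smul hline.contDiffAt).of_le (WithTop.coe_le_coe.2 le_top), ?_, ?_⟩, ?_⟩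
  · beta_reduce
    rw [hφ0, hline0, one_smul]
  · have hpos : ∀ᶠ t in 𝓝 (0 : ℝ), 0 < traceWrt (g + t • X).1 T.1 := by
      refine hφ.continuousAt.eventually (lt_mem_nhds ?_)
      beta_reduce
      rw [hφ0]; exact one_pos
    filter_upwards [(tendsto_line g X).eventually (eventually_mem_metrics hg.1), hpos] with t ht hp
    refine ⟨smul_mem_metrics ht hp, ?_⟩
    have := (isMetric_of_mem ht).traceWrt_smul_left hp.ne' T.1
    exact this.trans (inv_mul_cancel₀ hp.ne')
  · obtain ⟨L, hL, hLX⟩ := exists_hasFDerivAt_traceWrt_const hg.1 T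
    have hL' : HasFDerivAt (fun h : invariantTensors Q H => traceWrt h.1 T.1) L
      (g + (0 : ℝ) • X) := by rw [hline0]; exact hL
    have h1 := (hL'.comp_hasDerivAt (0 : ℝ) (hasDerivAt_line g X)).smul (hasDerivAt_line g X)
    refine h1.deriv.trans ?_
    rw [hLX, hX, Function.comp_apply, hφ0]
    simp

theorem mem_tangentSpaceOf_iff (hg : g ∈ metricsT T) {X : invariantTensors Q H} :
    X ∈ tangentSpaceOf (metricsT T) g ↔ innerWrt g.1 T.1 X.1 = 0 := by
  constructor
  · intro h
    induction h using Submodule.span_induction with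
    | mem X hX =>
      obtain ⟨γ, hγ, rfl⟩ := hX
      exact innerWrt_deriv_eq_zero hg hγ
    | zero =>
      have h2 : innerWrt g.1 T.1 ((0 : ℝ) • g.1) = 0 := by rw [innerWrt_smul_right, zero_mul]
      rw [zero_smul] at h2
      exact h2
    | add X Y _ _ hX hY =>
      exact (innerWrt_add_right _ _ _ _).trans (by rw [hX, hY, add_zero])
    | smul c X _ hX => exact (innerWrt_smul_right _ _ _ _).trans (by rw [hX, mul_zero])
  · intro h
    exact Submodule.subset_span (exists_isCurveIn hg h)

theorem eq_zero_of_innerWrt (hg : g ∈ metrics Q H) {A : Form2 (IsotropySpace Q H)}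
    (hA : A ∈ invariantTensors Q H) (h : innerWrt g.1 A A = 0) : A = 0 :=
  (isMetric_of_mem hg).eq_zero_of_innerWrt_self hA.1 h

/-- The critical points of `S` on `𝓜_T` are the solutions of `Ric(g) = c T`. -/
theorem isCriticalPt_iff : IsCriticalPt scalarCurvature (metricsT T) g ↔
    g ∈ metricsT T ∧ ∃ c : ℝ, ricci g = c • T.1 := by
  constructor
  · rintro ⟨hg, hcrit⟩
    refine ⟨hg, ?_⟩
    obtain ⟨L, hL, hLX⟩ := exists_hasFDerivAt_scalarCurvature hg.1
    have horth : ∀ X : invariantTensors Q H, innerWrt g.1 T.1 X.1 = 0 →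
        innerWrt g.1 (ricci g) X.1 = 0 := fun X hX => by
      obtain ⟨γ, hγ, hd⟩ := exists_isCurveIn hg hX
      have h1 : HasDerivAt γ X 0 := hd ▸ (hγ.1.differentiableAt (by norm_num)).hasDerivAt
      have hL' := hL
      rw [← hγ.2.1] at hL'
      have h2 := (hL'.comp_hasDerivAt (0 : ℝ) h1).unique (hcrit γ hγ)
      rw [hLX] at h2
      linarith
    -- `T` is non-zero because its trace is `1`.
    have hTT : innerWrt g.1 T.1 T.1 ≠ 0 := fun h => by
      have hT := eq_zero_of_innerWrt hg.1 T.2 h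
      have h1 := hg.2
      rw [hT] at h1
      simp [traceWrt, raise] at h1
    -- This is the `c` for which `Ric(g) - cT` is orthogonal to `T`, hence tangent. Criticality
    -- makes `Ric(g)` orthogonal to it, so it is orthogonal to itself.
    set c := innerWrt g.1 T.1 (ricci g) / innerWrt g.1 T.1 T.1 with hc
    refine ⟨c, ?_⟩
    have hZ : ricci g + (-c) • T.1 ∈ invariantTensors Q H :=
      add_mem (ricci_mem hg.1) (Submodule.smul_mem _ _ T.2)
    have hTZ : innerWrt g.1 T.1 (ricci g + (-c) • T.1) = 0 := by
      rw [innerWrt_add_right, innerWrt_smul_right, hc]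
      field_simp
      ring
    have h := eq_zero_of_innerWrt hg.1 hZ (by
      rw [innerWrt_add_left, innerWrt_smul_left, hTZ, horth ⟨_, hZ⟩ hTZ]
      ring)
    rw [neg_smul, ← sub_eq_add_neg, sub_eq_zero] at h
    exact h
  · rintro ⟨hg, c, hc⟩
    refine ⟨hg, fun γ hγ => ?_⟩
    obtain ⟨L, hL, hLX⟩ := exists_hasFDerivAt_scalarCurvature hg.1
    have h1 := (hγ.1.differentiableAt (by norm_num)).hasDerivAt
    rw [← hγ.2.1] at hL
    have h2 := hL.comp_hasDerivAt (0 : ℝ) h1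
    rw [hLX, hc, innerWrt_smul_left, innerWrt_deriv_eq_zero hg hγ, mul_zero, neg_zero] at h2
    exact h2

end Homogeneous

/-! ### Hessians -/

section Hessian

/-- The term with `γ''` in the chain rule disappears because `dF` vanishes at the point in all
ambient directions. -/
theorem iteratedDeriv_two_comp {W : Type*} [NormedAddCommGroup W] [NormedSpace ℝ W] {F : W → ℝ}
    {γ : ℝ → W} (hF : ContDiffAt ℝ 2 F (γ 0)) (hγ : ContDiffAt ℝ 2 γ 0)
    (h0 : fderiv ℝ F (γ 0) = 0) :
    iteratedDeriv 2 (F ∘ γ) 0 = fderiv ℝ (fderiv ℝ F) (γ 0) (deriv γ 0) (deriv γ 0) := by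
  have hγ1 : ∀ᶠ t in 𝓝 (0 : ℝ), DifferentiableAt ℝ γ t :=
    (hγ.eventually (by simp)).mono fun t ht => ht.differentiableAt (by norm_num)
  have hF1 : ∀ᶠ t in 𝓝 (0 : ℝ), DifferentiableAt ℝ F (γ t) :=
    hγ.continuousAt.eventually
      ((hF.eventually (by simp)).mono fun t ht => ht.differentiableAt (by norm_num))
  have hd : deriv (F ∘ γ) =ᶠ[𝓝 0] fun t => fderiv ℝ F (γ t) (deriv γ t) := by
    filter_upwards [hγ1, hF1] with t h1 h2
    exact (h2.hasFDerivAt.comp_hasDerivAt t h1.hasDerivAt).deriv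
  have hF2 : HasFDerivAt (fderiv ℝ F) (fderiv ℝ (fderiv ℝ F) (γ 0)) (γ 0) :=
    ((hF.fderiv_right (m := 1) (by norm_num)).differentiableAt (by norm_num)).hasFDerivAt
  have hγ2 : HasDerivAt (deriv γ) (deriv (deriv γ) 0) 0 := by
    have h1 : ContDiffAt ℝ 1 (fun t => fderiv ℝ γ t 1) 0 :=
      (hγ.fderiv_right (m := 1) (by norm_num)).clm_apply contDiffAt_const
    exact (h1.differentiableAt (by norm_num)).hasDerivAt
  have hγd : HasDerivAt γ (deriv γ 0) 0 := (hγ.differentiableAt (by norm_num)).hasDerivAt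
  have h3 := (hF2.comp_hasDerivAt (0 : ℝ) hγd).clm_apply hγ2
  rw [iteratedDeriv_succ, iteratedDeriv_one, hd.deriv_eq]
  refine h3.deriv.trans ?_
  simp [h0]

/-- Lagrange multipliers: on `N` the functions `f` and `f - cφ` differ by the constant `ca`, and the
latter is critical in the ambient space. -/
theorem iteratedDeriv_two_comp_of_isCurveIn {W : Type*} [NormedAddCommGroup W] [NormedSpace ℝ W]
    {N : Set W} {p : W} {f φ : W → ℝ} {a c : ℝ} (hf : ContDiffAt ℝ 2 f p) (hφ : ContDiffAt ℝ 2 φ p)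
    (hN : ∀ h ∈ N, φ h = a) (hd : fderiv ℝ (fun h => f h - c * φ h) p = 0) {γ : ℝ → W}
    (hγ : IsCurveIn N p γ) :
    ContDiffAt ℝ 2 (f ∘ γ) 0 ∧ iteratedDeriv 2 (f ∘ γ) 0 =
      fderiv ℝ (fderiv ℝ (fun h => f h - c * φ h)) p (deriv γ 0) (deriv γ 0) := by
  obtain ⟨hγc, rfl, hγN⟩ := hγ
  refine ⟨hf.comp 0 hγc, ?_⟩
  have hev : f ∘ γ =ᶠ[𝓝 0] fun t => c * a + ((fun h => f h - c * φ h) ∘ γ) t := by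
    filter_upwards [hγN] with t ht
    simp only [Function.comp_apply, hN _ ht]
    ring
  rw [hev.iteratedDeriv_eq 2, iteratedDeriv_const_add (by norm_num),
    iteratedDeriv_two_comp (hf.sub (contDiffAt_const.mul hφ)) hγc hd]

/-- Polarization. The quadratic form is determined only on velocities of curves, hence the
assumption that these fill the tangent space. -/
theorem IsHessianAt.unique {W : Type*} [NormedAddCommGroup W] [NormedSpace ℝ W]
    {N : Set W} {p : W} {f : W → ℝ}
    (hN : ∀ X ∈ tangentSpaceOf N p, ∃ γ, IsCurveIn N p γ ∧ deriv γ 0 = X)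
    {B B' : LinearMap.BilinForm ℝ (tangentSpaceOf N p)}
    (hB : IsHessianAt f N p B) (hB' : IsHessianAt f N p B') : B = B' := by
  have hdiag : ∀ X, B X X = B' X X := fun X => by
    obtain ⟨γ, hγ, hd⟩ := hN X X.2
    rw [← (hB.2 γ hγ X hd.symm).2, ← (hB'.2 γ hγ X hd.symm).2]
  refine LinearMap.ext fun X => LinearMap.ext fun Y => ?_
  have h := hdiag (X + Y)
  simp only [map_add, LinearMap.add_apply] at h
  rw [hdiag X, hdiag Y, hB.1 Y X, hB'.1 Y X] at h
  linarith

/-- Sard's theorem for the map `h ↦ ℓ(h) P(R(h))`. -/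
theorem ae_eq_zero_of_smul_add_smul {W V : Type*} [NormedAddCommGroup W] [NormedSpace ℝ W]
    [FiniteDimensional ℝ W] [MeasurableSpace W] [BorelSpace W] [NormedAddCommGroup V]
    [NormedSpace ℝ V] (μ : MeasureTheory.Measure W) [μ.IsAddHaarMeasure] {U : Set W} {R : W → V}
    {R' : W → W →L[ℝ] V} (hR : ∀ h ∈ U, HasFDerivAt R (R' h) h) (P : V →L[ℝ] W) (ℓ : W →L[ℝ] ℝ) :
    ∀ᵐ T ∂μ, ∀ h ∈ U, ℓ h • P (R h) = T →
      ∀ X, ℓ h • P (R' h X) + ℓ X • P (R h) = 0 → X = 0 := by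
  let Ψ : W → W := fun h => ℓ h • P (R h)
  let Ψ' : W → W →L[ℝ] W := fun h => ℓ h • (P ∘L R' h) + ℓ.smulRight (P (R h))
  have hΨ : ∀ h ∈ U, HasFDerivAt Ψ (Ψ' h) h := fun h hh =>
    ℓ.hasFDerivAt.smul (P.hasFDerivAt.comp h (hR h hh))
  -- `Ψ` maps `W` to itself, so its critical points are the zeros of the Jacobian determinant and
  -- their image is a null set.
  have hzero := MeasureTheory.addHaar_image_eq_zero_of_det_fderivWithin_eq_zero μ
    (s := {h | h ∈ U ∧ (Ψ' h).det = 0}) (f := Ψ) (f' := Ψ')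
    (fun h hh => (hΨ h hh.1).hasFDerivWithinAt) (fun h hh => hh.2)
  filter_upwards [MeasureTheory.measure_eq_zero_iff_ae_notMem.1 hzero] with T hT h hh hval X hX
  have hdet : (Ψ' h).det ≠ 0 := fun h0 => hT ⟨h, ⟨hh, h0⟩, hval⟩
  have hu : IsUnit (LinearMap.det (Ψ' h).toLinearMap) := isUnit_iff_ne_zero.2 hdet
  have hinj : Function.Injective (Ψ' h) :=
    ((Module.End.isUnit_iff _).1 ((LinearMap.isUnit_iff_isUnit_det _).2 hu)).1
  exact hinj ((show Ψ' h X = 0 from hX).trans (map_zero _).symm)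

/-- Let `R` be invariant under positive scaling. For almost every `T`, the kernel of the
differential of `R` at each solution `h` of `R(h) = c T` is spanned by `h`. -/
theorem ae_ker_eq_span {W V : Type*} [NormedAddCommGroup W] [NormedSpace ℝ W]
    [FiniteDimensional ℝ W] [MeasurableSpace W] [BorelSpace W] [NormedAddCommGroup V]
    [NormedSpace ℝ V] (μ : MeasureTheory.Measure W) [μ.IsAddHaarMeasure] {U : Set W} {R : W → V}
    {R' : W → W →L[ℝ] V} (hR : ∀ h ∈ U, HasFDerivAt R (R' h) h)
    (hU : ∀ h ∈ U, ∀ s : ℝ, 0 < s → s • h ∈ U) (hRs : ∀ h ∈ U, ∀ s : ℝ, 0 < s → R (s • h) = R h)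
    (hR's : ∀ h ∈ U, ∀ s : ℝ, 0 < s → ∀ X, s • R' (s • h) X = R' h X) (hR'h : ∀ h ∈ U, R' h h = 0)
    (ι : W → V) (P : V →L[ℝ] W) (hP : ∀ x, P (ι x) = x) (ℓ : W →L[ℝ] ℝ) :
    ∀ᵐ T ∂μ, ∀ h ∈ U, ∀ c : ℝ, 0 < c → R h = c • ι T → 0 < ℓ h →
      ∀ X, R' h X = 0 → ∃ a : ℝ, X = a • h := by
  filter_upwards [ae_eq_zero_of_smul_add_smul μ hR P ℓ] with T hT h hh c hc hRh hℓ X hX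
  -- Chosen so that `Ψ(s h) = s ℓ(h) c T = T`.
  set s := (c * ℓ h)⁻¹ with hs
  have hspos : 0 < s := inv_pos.2 (mul_pos hc hℓ)
  have hval : ℓ (s • h) • P (R (s • h)) = T := by
    have h1 : s * ℓ h * c = 1 := by rw [hs]; field_simp
    rw [hRs h hh s hspos, hRh, map_smul, map_smul, hP, smul_smul, smul_eq_mul, h1, one_smul]
  have hX' : R' (s • h) X = 0 :=
    (smul_eq_zero.1 ((hR's h hh s hspos X).trans hX)).resolve_left hspos.ne'
  have hh' : R' (s • h) h = 0 :=
    (smul_eq_zero.1 ((hR's h hh s hspos h).trans (hR'h h hh))).resolve_left hspos.ne'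
  -- The vector `ℓ(h) X - ℓ(X) h` is annihilated by `ℓ` and by the differential of `R` at `s h`,
  -- hence by that of `Ψ`.
  have hXh : ℓ h • X = ℓ X • h := by
    refine sub_eq_zero.1 (hT _ (hU h hh s hspos) hval _ ?_)
    simp only [map_sub, map_smul, hX', hh', smul_eq_mul]
    simp [mul_comm]
  refine ⟨(ℓ h)⁻¹ * ℓ X, ?_⟩
  rw [mul_smul, ← hXh, inv_smul_smul₀ hℓ.ne']

/-! ### The Hessian of the scalar curvature and the rank of `dRic_g`. -/

variable {E : Type*} [NormedAddCommGroup E] [NormedSpace ℝ E] [FiniteDimensional ℝ E]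
  {G : Type*} [TopologicalSpace G] [ChartedSpace E G] [Group G] [LieGroup 𝓘(ℝ, E) ∞ G]
  {Q : BiinvariantMetric E G} {H : Subgroup G} {T g : invariantTensors Q H}

/-- The bilinear form `-⟨dRic_g(X), Y⟩_g` on the tangent space of `𝓜_T`. -/
def ricciHessian (T g : invariantTensors Q H) :
    LinearMap.BilinForm ℝ (tangentSpaceOf (metricsT T) g) :=
  LinearMap.mk₂ ℝ (fun X Y => -innerWrt g.1 (dRicci g X) (Y : invariantTensors Q H).1)
    (fun X X' Y => by
      rw [Submodule.coe_add, map_add, innerWrt_add_left, neg_add])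
    (fun c X Y => by
      rw [Submodule.coe_smul, map_smul, innerWrt_smul_left, smul_eq_mul, mul_neg])
    (fun X Y Y' => by
      rw [Submodule.coe_add, Submodule.coe_add, innerWrt_add_right, neg_add])
    (fun c X Y => by
      rw [Submodule.coe_smul, Submodule.coe_smul, innerWrt_smul_right, smul_eq_mul, mul_neg])

theorem ricciHessian_apply (X Y : tangentSpaceOf (metricsT T) g) :
    ricciHessian T g X Y = -innerWrt g.1 (dRicci g X) (Y : invariantTensors Q H).1 := rfl

/-- At a solution of `Ric(g) = c T`, the second derivative of `S - c tr_g T` is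
`-⟨dRic_g(X), Y⟩_g`. -/
theorem fderiv_fderiv_scalarCurvature_sub (hg : g ∈ metrics Q H) {c : ℝ}
    (hc : ricci g = c • T.1) :
    fderiv ℝ (fun h : invariantTensors Q H => scalarCurvature h - c * traceWrt h.1 T.1) g = 0 ∧
    ∀ X Y, fderiv ℝ (fderiv ℝ
      (fun h : invariantTensors Q H => scalarCurvature h - c * traceWrt h.1 T.1)) g X Y =
      -innerWrt g.1 (dRicci g X) Y.1 := by
  set F := fun h : invariantTensors Q H => scalarCurvature h - c * traceWrt h.1 T.1 with hFdef
  -- The formula holds at every metric and not only at `g`, so it can be differentiated once more.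
  have hF1 : ∀ h ∈ metrics Q H, ∀ X,
      fderiv ℝ F h X = -innerWrt h.1 (ricci h + (-c) • T.1) X.1 := fun h hh X => by
    obtain ⟨L, hL, hLX⟩ := exists_hasFDerivAt_scalarCurvature hh
    obtain ⟨M, hM, hMX⟩ := exists_hasFDerivAt_traceWrt_const hh T
    have hF' : HasFDerivAt F (L - c • M) h := hL.sub (hM.const_mul c)
    rw [hF'.fderiv, innerWrt_add_left, innerWrt_smul_left, sub_apply,
      smul_apply, hLX, hMX, smul_eq_mul]
    ring
  have hv0 : ricci g + (-c) • T.1 = 0 := by rw [hc, neg_smul, add_neg_cancel]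
  refine ⟨?_, fun X Y => ?_⟩
  · ext X
    rw [hF1 g hg, hv0]
    simp [innerWrt, raise]
  · have hF : ContDiffAt ℝ ∞ F g :=
      (contDiffAt_scalarCurvature hg).sub (contDiffAt_const.mul (contDiffAt_traceWrt_const hg T))
    have h1 : HasFDerivAt (fderiv ℝ F) (fderiv ℝ (fderiv ℝ F) g) g :=
      ((hF.fderiv_right (m := 1) (WithTop.coe_le_coe.2 le_top)).differentiableAt
        (by norm_num)).hasFDerivAt
    have h2 := h1.clm_apply (hasFDerivAt_const Y g)
    -- As `Ric(h) - cT` vanishes at `h = g`, the dependence of the inner product on `h` contributes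
    -- nothing.
    obtain ⟨L, hL, hLX⟩ := exists_hasFDerivAt_innerWrt (isMetric_of_mem hg) (hasFDerivAt_coe g)
      ((hasFDerivAt_ricci hg).add_const ((-c) • T.1)) hv0 Y.1
    have h3 := h2.unique (hL.neg.congr_of_eventuallyEq (by
      filter_upwards [eventually_mem_metrics hg] with h hh
      exact hF1 h hh Y))
    have h4 := congrArg (fun L : invariantTensors Q H →L[ℝ] ℝ => L X) h3
    simp only [neg_apply, hLX] at h4
    rw [← h4]
    simp

theorem isHessianAt_ricciHessian (hg : g ∈ metricsT T) {c : ℝ} (hc : ricci g = c • T.1) :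
    IsHessianAt scalarCurvature (metricsT T) g (ricciHessian T g) := by
  have h2 : (2 : WithTop ℕ∞) ≤ ∞ := WithTop.coe_le_coe.2 le_top
  have hS := (contDiffAt_scalarCurvature hg.1).of_le h2
  have hφ := (contDiffAt_traceWrt_const hg.1 T).of_le h2
  obtain ⟨hF0, hF2⟩ := fderiv_fderiv_scalarCurvature_sub hg.1 hc
  refine ⟨fun X Y => ?_, fun γ hγ X hX => ?_⟩
  -- The symmetry of `⟨dRic_g(X), Y⟩_g` is inherited from the second derivative of `S - c tr_g T`.
  · rw [ricciHessian_apply, ricciHessian_apply, ← hF2, ← hF2]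
    exact (hS.sub (contDiffAt_const.mul hφ)).isSymmSndFDerivAt (by simp) _ _
  · have h := iteratedDeriv_two_comp_of_isCurveIn (a := 1) hS hφ (fun h hh => hh.2) hF0 hγ
    refine ⟨h.1, h.2.trans ((hF2 _ _).trans ?_)⟩
    rw [← hX]
    exact (ricciHessian_apply X X).symm

/-- A solution of `Ric(g) = c T` is a non-degenerate critical point if and only if `dRic_g` is
injective on the tangent space of `𝓜_T`. -/
theorem isNondegenerateCriticalPt_iff (hg : g ∈ metricsT T) {c : ℝ} (hc : ricci g = c • T.1) :
    IsNondegenerateCriticalPt scalarCurvature (metricsT T) g ↔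
      ∀ X : invariantTensors Q H, innerWrt g.1 T.1 X.1 = 0 → dRicci g X = 0 → X = 0 := by
  constructor
  · rintro ⟨-, B, hB, hnd⟩ X hX hdX
    rw [IsHessianAt.unique (fun X hX => exists_isCurveIn hg ((mem_tangentSpaceOf_iff hg).1 hX)) hB
      (isHessianAt_ricciHessian hg hc)] at hnd
    have h := hnd ⟨X, (mem_tangentSpaceOf_iff hg).2 hX⟩ fun Y => by
      rw [ricciHessian_apply, hdX]
      simp [innerWrt, raise]
    exact congrArg Subtype.val h
  · intro hinj
    refine ⟨isCriticalPt_iff.2 ⟨hg, c, hc⟩, ricciHessian T g, isHessianAt_ricciHessian hg hc,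
      fun X hX => ?_⟩
    apply Subtype.ext
    refine hinj X ((mem_tangentSpaceOf_iff hg).1 X.2) ?_
    have hZ := dRicci_mem hg.1 (X : invariantTensors Q H)
    refine eq_zero_of_innerWrt hg.1 hZ ?_
    set Z := dRicci g (X : invariantTensors Q H) with hZdef
    -- Subtracting `a g` makes `Z` tangent, because `⟨T, g⟩_g = 1`. Since `⟨Z, g⟩_g = tr_g Z = 0`,
    -- pairing `Z` with the corrected vector gives `⟨Z, Z⟩_g`.
    set a := innerWrt g.1 T.1 Z with ha
    have hY : innerWrt g.1 T.1 (Z + (-a) • g.1) = 0 := by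
      rw [innerWrt_add_right, innerWrt_smul_right, innerWrt_self_right_of_mem hg, ← ha]
      ring
    have hmem : Z + (-a) • g.1 ∈ invariantTensors Q H := add_mem hZ (Submodule.smul_mem _ _ g.2)
    have h1 := hX ⟨⟨_, hmem⟩, (mem_tangentSpaceOf_iff hg).2 hY⟩
    rw [ricciHessian_apply, ← hZdef, innerWrt_add_right, innerWrt_smul_right,
      (isMetric_of_mem hg.1).innerWrt_self_right, hZdef, traceWrt_dRicci hg.1] at h1
    linarith

/-- By rank-nullity the rank condition says that the kernel of `f` is the line through `u`. Since
`φ(u) = 1`, that line is a complement of `ker φ`. It is applied with `u = g` and `φ = ⟨T, ·⟩_g`. -/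
theorem finrank_range_add_one_iff {U W : Type*} [AddCommGroup U] [Module ℝ U]
    [FiniteDimensional ℝ U] [AddCommGroup W] [Module ℝ W] (f : U →ₗ[ℝ] W) (φ : U →ₗ[ℝ] ℝ) {u : U}
    (hu : f u = 0) (hφ : φ u = 1) :
    Module.finrank ℝ (LinearMap.range f) + 1 = Module.finrank ℝ U ↔
      ∀ x, φ x = 0 → f x = 0 → x = 0 := by
  have hker : Module.finrank ℝ (LinearMap.range f) + 1 = Module.finrank ℝ U ↔
      Module.finrank ℝ (LinearMap.ker f) = 1 := by
    rw [← f.finrank_range_add_finrank_ker]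
    exact Nat.add_left_cancel_iff.trans eq_comm
  have hne : (⟨u, hu⟩ : LinearMap.ker f) ≠ 0 := fun h => by
    have h0 : u = 0 := congrArg Subtype.val h
    rw [h0, map_zero] at hφ
    exact zero_ne_one hφ
  rw [hker, finrank_eq_one_iff_of_nonzero' _ hne]
  constructor
  · intro h x hx hfx
    obtain ⟨a, ha⟩ := h ⟨x, hfx⟩
    have ha' : a • u = x := congrArg Subtype.val ha
    rw [← ha', map_smul, hφ, smul_eq_mul, mul_one] at hx
    rw [← ha', hx, zero_smul]
  · rintro h ⟨x, hfx⟩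
    refine ⟨φ x, Subtype.ext ?_⟩
    have h1 := h (x - φ x • u) (by simp [hφ]) (by
      rw [map_sub, map_smul, hu, smul_zero, sub_zero]; exact hfx)
    exact (sub_eq_zero.1 h1).symm

theorem finrank_range_dRicci_iff (hg : g ∈ metricsT T) :
    Module.finrank ℝ (dRicci g).range + 1 = Module.finrank ℝ (invariantTensors Q H) ↔
      ∀ X : invariantTensors Q H, innerWrt g.1 T.1 X.1 = 0 → dRicci g X = 0 → X = 0 :=
  finrank_range_add_one_iff (dRicci g).toLinearMap
    { toFun := fun X : invariantTensors Q H => innerWrt g.1 T.1 X.1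
      map_add' := fun _ _ => innerWrt_add_right _ _ _ _
      map_smul' := fun _ _ => innerWrt_smul_right _ _ _ _ }
    (dRicci_self hg.1) (innerWrt_self_right_of_mem hg)

/-! ### Positivity of the Einstein constant and the generic non-degeneracy -/

theorem lie_incl_of_basis {n : ℕ} (e : OrthonormalBasis (Fin n) ℝ (IsotropySpace Q H))
    (h : ∀ i j, ⁅incl Q H (e i), incl Q H (e j)⁆ = 0) (u v : IsotropySpace Q H) :
    ⁅incl Q H u, incl Q H v⁆ = 0 := by
  rw [← e.sum_repr' u, ← e.sum_repr' v]
  simp only [map_sum, map_smul, sum_lie, lie_sum, smul_lie, lie_smul, h,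
    smul_zero, Finset.sum_const_zero]

/-- A trace of the Ricci tensor with respect to `Q` is positive. -/
theorem traceWrt_ricci_pos
    (hflat : ∃ X ∈ isotropyModule Q H, ∃ Y : GroupLieAlgebra 𝓘(ℝ, E) G, ⁅Y, X⁆ ≠ 0)
    (hg : g ∈ metrics Q H) : 0 < traceWrt (euclideanForm (IsotropySpace Q H)) (ricci g) := by
  by_contra hle
  obtain ⟨e, x, hd⟩ := (isMetric_of_mem hg).exists_isDiag
  rw [(isDiag_euclideanForm e).traceWrt_eq isMetric_euclideanForm] at hle
  simp only [div_one, not_lt] at hle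
  obtain ⟨h1, h2⟩ := hd.bracket_eq_zero (isMetric_of_mem hg) (isBracket Q H) hle
  have h3 : ∀ i j, ⁅incl Q H (e i), incl Q H (e j)⁆ = 0 := fun i j => by
    have hz : bracketH Q H (e i) (e j) = 0 := by
      by_contra hne
      have h4 := h2 i j
      rw [inner_bracketHM_self] at h4
      have := Q.pos _ hne
      linarith
    rw [← incl_bracketM_add_bracketH, h1, hz, map_zero, add_zero]
  obtain ⟨X, hX, Y, hne⟩ := hflat
  exact hne (lie_incl_eq_zero (lie_incl_of_basis e h3) Y ⟨X, hX⟩)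

theorem traceWrt_euclideanForm_pos [Nontrivial (IsotropySpace Q H)]
    {A : Form2 (IsotropySpace Q H)} (hA : ∀ u, u ≠ 0 → 0 < A u u) :
    0 < traceWrt (euclideanForm (IsotropySpace Q H)) A := by
  let e := stdOrthonormalBasis ℝ (IsotropySpace Q H)
  rw [(isDiag_euclideanForm e).traceWrt_eq isMetric_euclideanForm]
  have : Nonempty (Fin (Module.finrank ℝ (IsotropySpace Q H))) :=
    ⟨⟨0, Module.finrank_pos⟩⟩
  refine Finset.sum_pos (fun i _ => ?_) Finset.univ_nonempty
  rw [div_one]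
  exact hA _ (e.orthonormal.ne_zero i)

variable (Q H) in
/-- The linear functional `A ↦ tr_Q A`. -/
def traceQ : invariantTensors Q H →L[ℝ] ℝ :=
  LinearMap.toContinuousLinearMap
    { toFun := fun A => traceWrt (euclideanForm (IsotropySpace Q H)) A.1
      map_add' := fun _ _ => traceWrt_add _ _ _
      map_smul' := fun _ _ => traceWrt_smul _ _ _ }

theorem nontrivial_isotropySpace
    (hflat : ∃ X ∈ isotropyModule Q H, ∃ Y : GroupLieAlgebra 𝓘(ℝ, E) G, ⁅Y, X⁆ ≠ 0) :
    Nontrivial (IsotropySpace Q H) := by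
  obtain ⟨X, hX, Y, hne⟩ := hflat
  refine ⟨⟨⟨X, hX⟩, 0, fun h => hne ?_⟩⟩
  have h0 : X = 0 := congrArg Subtype.val h
  rw [h0, lie_zero]

/-- Take the `Q`-trace of `Ric(g) = cT`: both `tr_Q Ric(g)` and `tr_Q T` are positive. -/
theorem pos_of_ricci_eq
    (hflat : ∃ X ∈ isotropyModule Q H, ∃ Y : GroupLieAlgebra 𝓘(ℝ, E) G, ⁅Y, X⁆ ≠ 0)
    (hT : IsPosDef T) (hg : g ∈ metrics Q H) {c : ℝ} (hc : ricci g = c • T.1) : 0 < c := by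
  have h1 := traceWrt_ricci_pos hflat hg
  have : Nontrivial (IsotropySpace Q H) := nontrivial_isotropySpace hflat
  have h2 := traceWrt_euclideanForm_pos hT
  rw [hc, traceWrt_smul] at h1
  exact pos_of_mul_pos_left h1 h2.le

/-- For almost every `T`, the differential `dRic_g` is injective on the tangent space of `𝓜_T` at
each solution `g` of `Ric(g) = c T` with `c > 0`. -/
theorem ae_injective_dRicci (μ : MeasureTheory.Measure (invariantTensors Q H))
    [μ.IsAddHaarMeasure] :
    ∀ᵐ T ∂μ, ∀ g ∈ metricsT T, ∀ c : ℝ, 0 < c → ricci g = c • T.1 → 0 < traceQ Q H g →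
      ∀ X : invariantTensors Q H, innerWrt g.1 T.1 X.1 = 0 → dRicci g X = 0 → X = 0 := by
  -- A linear projection onto `𝒯` turns `h ↦ tr_Q(h) Ric(h)` into a self-map of `𝒯`, as the
  -- determinant form of Sard's theorem requires.
  obtain ⟨P, hP⟩ := Submodule.ClosedComplemented.of_finiteDimensional (𝕜 := ℝ)
    (invariantTensors Q H)
  filter_upwards [ae_ker_eq_span μ (fun h hh => hasFDerivAt_ricci hh)
    (fun h hh s hs => smul_mem_metrics hh hs) (fun h hh s hs => ricci_smul hh hs)
    (fun h hh s hs => dRicci_smul hh hs) (fun h hh => dRicci_self hh) Subtype.val P hP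
    (traceQ Q H)] with T hT g hg c hc hric htr X hX hdX
  -- The kernel is the line through `g`, which meets `T^⊥` only in zero since `⟨T, g⟩_g = 1`.
  obtain ⟨a, rfl⟩ := hT g hg.1 c hc hric htr X hdX
  have h1 : innerWrt g.1 T.1 (a • g).1 = a * innerWrt g.1 T.1 g.1 := innerWrt_smul_right _ _ _ _
  rw [hX, innerWrt_self_right_of_mem hg, mul_one] at h1
  rw [← h1, zero_smul]

end Hessian

end HomSpace

end

theorem mainTheorem6
    {E : Type*} [NormedAddCommGroup E] [NormedSpace ℝ E] [FiniteDimensional ℝ E]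
    {G : Type*} [TopologicalSpace G] [ChartedSpace E G] [Group G] [LieGroup 𝓘(ℝ, E) ∞ G]
    [T2Space G] [CompactSpace G]
    (H : Subgroup G) (hH : IsClosed (H : Set G))
    (Q : BiinvariantMetric E G)
    (hflat : ∃ X ∈ isotropyModule Q H, ∃ Y : GroupLieAlgebra 𝓘(ℝ, E) G, ⁅Y, X⁆ ≠ 0) :
    (∀ g ∈ metrics Q H, ricci g ∈ invariantTensors Q H ∧
      ContDiffAt ℝ ∞ (ricci (Q := Q) (H := H)) g) ∧
    (∀ T : invariantTensors Q H, IsPosDef T →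
      ∀ g, IsCriticalPt scalarCurvature (metricsT T) g →
        ∃ B, IsHessianAt scalarCurvature (metricsT T) g B ∧
          ∀ X Y, B X Y = -innerWrt g.1 (dRicci g X) (Y : invariantTensors Q H).1) ∧
    (∀ T : invariantTensors Q H, IsPosDef T →
      ∀ g ∈ metricsT T, ∀ c : ℝ, 0 < c → ricci g = c • T.1 →
        (IsNondegenerateCriticalPt scalarCurvature (metricsT T) g ↔
          Module.finrank ℝ (dRicci g).range + 1 = Module.finrank ℝ (invariantTensors Q H))) ∧
    (∀ μ : MeasureTheory.Measure (invariantTensors Q H), μ.IsAddHaarMeasure →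
      ∀ᵐ T ∂μ, IsPosDef T → IsMorseOn scalarCurvature (metricsT T)) := by
  refine ⟨fun g hg => ⟨ricci_mem hg, contDiffAt_ricci hg⟩, fun T _ g hcrit => ?_,
    fun T _ g hg c _ hc => (isNondegenerateCriticalPt_iff hg hc).trans
      (finrank_range_dRicci_iff hg).symm, fun μ hμ => ?_⟩
  · obtain ⟨hg, c, hc⟩ := isCriticalPt_iff.1 hcrit
    exact ⟨ricciHessian T g, isHessianAt_ricciHessian hg hc, fun X Y => ricciHessian_apply X Y⟩
  · have : Nontrivial (IsotropySpace Q H) := nontrivial_isotropySpace hflat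
    filter_upwards [ae_injective_dRicci μ] with T hT hpos
    refine ⟨fun p hp => contDiffAt_scalarCurvature hp.1, fun g hcrit => ?_⟩
    obtain ⟨hg, c, hc⟩ := isCriticalPt_iff.1 hcrit
    exact (isNondegenerateCriticalPt_iff hg hc).2 (hT g hg c
      (pos_of_ricci_eq hflat hpos hg.1 hc) hc (traceWrt_euclideanForm_pos hg.1))
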